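/- **Theorem.** All graphs are finite and simple. For a graph $G$, a set $S\subseteq V(G)$ is *2-dominating* if every vertex outside $S$ has at least two neighbours in $S$, and *2-independent* if every vertex of $S$ has at most one neighbour in $S$; $\gamma_2(G)$ is the minimum cardinality of a 2-dominating set and $\alpha_2(G)$ the maximum cardinality of a 2-independent set. *Special trees.* Each of the following trees has exactly one white vertex, all its other vertices being black, and a specified vertex $v$. Write $P_n$ for the path $0,1,\dots,n-1$. - $T_1$: $P_3$, white $1$, $v=1$. $T_2$: $P_3$, white $2$, $v=2$. $T_3$: $P_4$, white $3$, $v=1$. $T_4$: $P_4$, white $1$, $v=3$. $T_5$: $P_5$, white $1$, $v=1$. $T_6$: $P_5$, white $4$, $v=v_2=4$, $v_1=0$. $T_7$: $P_6$, white $5$, $v=3$. $T_8$: $P_6$, white $1$, $v=1$. $T_9$: $P_7$, white $6$, $v=6$. $T_{10}$: $P_7$, white $3$, $v=3$. - $T_{11}$: edges $01,02,03,34,45,56$, white $0$, $v=6$. - $T_{12}$: edges $01,12,23,34,15,06$, white $0$, $v=5$. $T_{13}$: the same coloured tree with $v=6$. - $T_{14}$: edges $01,12,23,34,45,26,17$,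 white $0$, $v=v_1=0$, $v_2=1$. - $T_{15}$: edges $01,12,23,14,25,36,37$, white $3$, $v=0$. A *PDI-subtree* (prescribed-degree-induced subtree) $S$ of a tree $T'$, where $S$ is a special tree, is an induced subgraph of $T'$ isomorphic to $S$ (with colours and specified vertices transferred along an isomorphism) such that every black vertex has the same degree in $T'$ as in $S$. Let $\mathcal T$ be the smallest family of trees, closed under isomorphism, that contains all trees of order at most $4$ and is closed under the following operations, each of which turns a tree $T'$ into a tree $T$ (the vertices $u,u_1,u_2,u_3$ are new): - $\mathcal O_1$: let $v=v(S)$ for a PDI-subtree $S\in\{T_1,T_2,T_8\}$ of $T'$; add a vertex $u$ and the edge $vu$. - $\mathcal O_2$: let $v=v(S)$ for a PDI-subtree $S\in\{T_4,T_{11},T_{12},T_{13},T_{15}\}$ of $T'$; add a path $u_1u_2$ and the edge $vu_1$. - $\mathcal O_3$: let $v$ be any vertex of $T'$; add a path $u_1u_2u_3$ and the edge $vu_2$. - $\mathcal O_4$: let $v=v(S)$ for a PDI-subtree $S\in\{T_1,T_2,T_3,T_5,T_6,T_7,T_9,T_{10},T_{14}\}$ of $T'$; add a path $u_1u_2u_3$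 and the edge $vu_1$. - $\mathcal O_5$: let $v_1,v_2$ be the specified vertices of a PDI-subtree $T_6$ of $T'$; add a path $u_1u_3$ and the edge $v_1u_1$, and add a vertex $u_2$ and the edge $v_2u_2$. - $\mathcal O_6$: let $v_1,v_2$ be the specified vertices of a PDI-subtree $T_{14}$ of $T'$; remove the edge $v_1v_2$ and add a path $u_1u_2u_3$ and the edges $v_1u_1$ and $v_2u_2$. Then a tree $T$ satisfies $\gamma_2(T)=\alpha_2(T)$ if and only if $T\in\mathcal T$. -/

import Mathlib

universe u

namespace TwoDom

/-- `S` is a `k`-dominating set: every vertex outside `S` has at least `k` neighbours in `S`. -/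
def IsKDominating {V : Type u} (G : SimpleGraph V) (k : ℕ) (S : Set V) : Prop :=
  ∀ v, v ∉ S → k ≤ (G.neighborSet v ∩ S).ncard

/-- `S` is a `k`-independent set: every vertex of `S` has at most `k - 1` neighbours in `S`. -/
def IsKIndependent {V : Type u} (G : SimpleGraph V) (k : ℕ) (S : Set V) : Prop :=
  ∀ v, v ∈ S → (G.neighborSet v ∩ S).ncard < k

/-- The `k`-domination number of a finite graph. -/
noncomputable def kDominationNumber {V : Type u} (G : SimpleGraph V) (k : ℕ) : ℕ :=
  sInf {n | ∃ S : Set V, IsKDominating G k S ∧ S.ncard = n}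

/-- The `k`-independence number of a finite graph. -/
noncomputable def kIndependenceNumber {V : Type u} (G : SimpleGraph V) (k : ℕ) : ℕ :=
  sSup {n | ∃ S : Set V, IsKIndependent G k S ∧ S.ncard = n}

/-- The graph on `Fin n` with the listed edges. -/
def edgeGraph (n : ℕ) (l : List (Fin n × Fin n)) : SimpleGraph (Fin n) :=
  SimpleGraph.fromRel fun a b => (a, b) ∈ l

/-- A special tree, with its unique white vertex (all other vertices are black) and its
specified vertex `v`. -/
structure SpecialTree where
  order : ℕ
  graph : SimpleGraph (Fin order)
  white : Fin order
  v : Fin order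

/-- Black, white, black along a path; `v` is the (white) centre. -/
def T₁ : SpecialTree := ⟨3, edgeGraph 3 [(0, 1), (1, 2)], 1, 1⟩

def T₂ : SpecialTree := ⟨3, edgeGraph 3 [(0, 1), (1, 2)], 2, 2⟩

def T₃ : SpecialTree := ⟨4, edgeGraph 4 [(0, 1), (1, 2), (2, 3)], 3, 1⟩

def T₄ : SpecialTree := ⟨4, edgeGraph 4 [(0, 1), (1, 2), (2, 3)], 1, 3⟩

def T₅ : SpecialTree := ⟨5, edgeGraph 5 [(0, 1), (1, 2), (2, 3), (3, 4)], 1, 1⟩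

/-- Here `v = v₂` is the white end of the path; `v₁` is the other end. -/
def T₆ : SpecialTree := ⟨5, edgeGraph 5 [(0, 1), (1, 2), (2, 3), (3, 4)], 4, 4⟩

def T₇ : SpecialTree := ⟨6, edgeGraph 6 [(0, 1), (1, 2), (2, 3), (3, 4), (4, 5)], 5, 3⟩

def T₈ : SpecialTree := ⟨6, edgeGraph 6 [(0, 1), (1, 2), (2, 3), (3, 4), (4, 5)], 1, 1⟩

def T₉ : SpecialTree := ⟨7, edgeGraph 7 [(0, 1), (1, 2), (2, 3), (3, 4), (4, 5), (5, 6)], 6, 6⟩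

def T₁₀ : SpecialTree := ⟨7, edgeGraph 7 [(0, 1), (1, 2), (2, 3), (3, 4), (4, 5), (5, 6)], 3, 3⟩

/-- The white vertex `0` carries two leaves and a pendant path `3, 4, 5, 6`. -/
def T₁₁ : SpecialTree := ⟨7, edgeGraph 7 [(0, 1), (0, 2), (0, 3), (3, 4), (4, 5), (5, 6)], 0, 6⟩

/-- The path `0, 1, 2, 3, 4` starting at the white vertex, with a leaf `5` at `1` and a leaf `6`
at `0`; here `v` is the leaf at `1`. -/
def T₁₂ : SpecialTree := ⟨7, edgeGraph 7 [(0, 1), (1, 2), (2, 3), (3, 4), (1, 5), (0, 6)], 0, 5⟩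

/-- The same coloured tree as `T₁₂`; here `v` is the leaf at the white vertex. -/
def T₁₃ : SpecialTree := ⟨7, edgeGraph 7 [(0, 1), (1, 2), (2, 3), (3, 4), (1, 5), (0, 6)], 0, 6⟩

/-- The path `0, 1, 2, 3, 4, 5` starting at the white vertex `v = v₁`, with a leaf `6` at `2` and
a leaf `7` at `v₂ = 1`. -/
def T₁₄ : SpecialTree :=
  ⟨8, edgeGraph 8 [(0, 1), (1, 2), (2, 3), (3, 4), (4, 5), (2, 6), (1, 7)], 0, 0⟩

/-- The path `0, 1, 2, 3` ending at the white vertex, with a leaf at `1`, a leaf at `2` and two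
leaves at `3`. -/
def T₁₅ : SpecialTree :=
  ⟨8, edgeGraph 8 [(0, 1), (1, 2), (2, 3), (1, 4), (2, 5), (3, 6), (3, 7)], 3, 0⟩

/-- The vertex `v₁` of `T₆`. -/
def T₆v₁ : Fin T₆.order := (0 : Fin 5)

/-- The vertex `v₂` of `T₆`. -/
def T₆v₂ : Fin T₆.order := (4 : Fin 5)

/-- The vertex `v₁` of `T₁₄`. -/
def T₁₄v₁ : Fin T₁₄.order := (0 : Fin 8)

/-- The vertex `v₂` of `T₁₄`. -/
def T₁₄v₂ : Fin T₁₄.order := (1 : Fin 8)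

/-- The induced copy `e` of the special tree `S` in `G` is a prescribed-degree-induced subtree:
every black vertex has the same degree in `G` as in `S`. -/
def IsPDI {V : Type u} (S : SpecialTree) (G : SimpleGraph V) (e : S.graph ↪g G) : Prop :=
  ∀ x, x ≠ S.white → (G.neighborSet (e x)).ncard = (S.graph.neighborSet x).ncard

/-- `w` is the vertex `v(S)` of some PDI-subtree `S` of `G`. -/
def IsAttacher {V : Type u} (S : SpecialTree) (G : SimpleGraph V) (w : V) : Prop :=
  ∃ e : S.graph ↪g G, IsPDI S G e ∧ w = e S.v

/-- `W` consists of a copy (under `f`) of `V` and the distinct new vertices listed in `l`. -/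
def NewVertices {V W : Type u} (f : V ↪ W) (l : List W) : Prop :=
  l.Nodup ∧ ∀ w, w ∈ l ↔ w ∉ Set.range f

/-- `G` arises from `G'` by adding a vertex `u` and the edge `vu`. -/
def Op₁ {V W : Type u} (G' : SimpleGraph V) (G : SimpleGraph W) : Prop :=
  ∃ S ∈ ({T₁, T₂, T₈} : Set SpecialTree), ∃ v, IsAttacher S G' v ∧
    ∃ (f : V ↪ W) (u : W), NewVertices f [u] ∧
      G = G'.map f ⊔ SimpleGraph.fromEdgeSet {s(f v, u)}

/-- `G` arises from `G'` by adding a path `u₁u₂` and the edge `vu₁`. -/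
def Op₂ {V W : Type u} (G' : SimpleGraph V) (G : SimpleGraph W) : Prop :=
  ∃ S ∈ ({T₄, T₁₁, T₁₂, T₁₃, T₁₅} : Set SpecialTree), ∃ v, IsAttacher S G' v ∧
    ∃ (f : V ↪ W) (u₁ u₂ : W), NewVertices f [u₁, u₂] ∧
      G = G'.map f ⊔ SimpleGraph.fromEdgeSet {s(u₁, u₂), s(f v, u₁)}

/-- `G` arises from `G'` by adding a path `u₁u₂u₃` and the edge `vu₂`, with `v` arbitrary. -/
def Op₃ {V W : Type u} (G' : SimpleGraph V) (G : SimpleGraph W) : Prop :=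
  ∃ (v : V) (f : V ↪ W) (u₁ u₂ u₃ : W), NewVertices f [u₁, u₂, u₃] ∧
    G = G'.map f ⊔ SimpleGraph.fromEdgeSet {s(u₁, u₂), s(u₂, u₃), s(f v, u₂)}

/-- `G` arises from `G'` by adding a path `u₁u₂u₃` and the edge `vu₁`. -/
def Op₄ {V W : Type u} (G' : SimpleGraph V) (G : SimpleGraph W) : Prop :=
  ∃ S ∈ ({T₁, T₂, T₃, T₅, T₆, T₇, T₉, T₁₀, T₁₄} : Set SpecialTree), ∃ v, IsAttacher S G' v ∧
    ∃ (f : V ↪ W) (u₁ u₂ u₃ : W), NewVertices f [u₁, u₂, u₃] ∧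
      G = G'.map f ⊔ SimpleGraph.fromEdgeSet {s(u₁, u₂), s(u₂, u₃), s(f v, u₁)}

/-- `G` arises from `G'` by adding a path `u₁u₃` and the edge `v₁u₁`, and a vertex `u₂` and the
edge `v₂u₂`. -/
def Op₅ {V W : Type u} (G' : SimpleGraph V) (G : SimpleGraph W) : Prop :=
  ∃ e : T₆.graph ↪g G', IsPDI T₆ G' e ∧
    ∃ (f : V ↪ W) (u₁ u₂ u₃ : W), NewVertices f [u₁, u₂, u₃] ∧
      G = G'.map f ⊔ SimpleGraph.fromEdgeSet
        {s(u₁, u₃), s(f (e T₆v₁), u₁), s(f (e T₆v₂), u₂)}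

/-- `G` arises from `G'` by removing the edge `v₁v₂` and adding a path `u₁u₂u₃` and the edges
`v₁u₁` and `v₂u₂`. -/
def Op₆ {V W : Type u} (G' : SimpleGraph V) (G : SimpleGraph W) : Prop :=
  ∃ e : T₁₄.graph ↪g G', IsPDI T₁₄ G' e ∧
    ∃ (f : V ↪ W) (u₁ u₂ u₃ : W), NewVertices f [u₁, u₂, u₃] ∧
      G = (G'.deleteEdges {s(e T₁₄v₁, e T₁₄v₂)}).map f ⊔ SimpleGraph.fromEdgeSet
        {s(u₁, u₂), s(u₂, u₃), s(f (e T₁₄v₁), u₁), s(f (e T₁₄v₂), u₂)}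

/-- The smallest family that contains all trees of order at most `4` and is closed under the six
operations (which are taken up to isomorphism). -/
inductive TreeFamily : ∀ {V : Type u}, SimpleGraph V → Prop
  | small {V : Type u} [Finite V] (G : SimpleGraph V) (hG : G.IsTree) (hV : Nat.card V ≤ 4) :
      TreeFamily G
  | op₁ {V W : Type u} {G' : SimpleGraph V} {G : SimpleGraph W} :
      TreeFamily G' → Op₁ G' G → TreeFamily G
  | op₂ {V W : Type u} {G' : SimpleGraph V} {G : SimpleGraph W} :
      TreeFamily G' → Op₂ G' G → TreeFamily G
  | op₃ {V W : Type u} {G' : SimpleGraph V} {G : SimpleGraph W} :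
      TreeFamily G' → Op₃ G' G → TreeFamily G
  | op₄ {V W : Type u} {G' : SimpleGraph V} {G : SimpleGraph W} :
      TreeFamily G' → Op₄ G' G → TreeFamily G
  | op₅ {V W : Type u} {G' : SimpleGraph V} {G : SimpleGraph W} :
      TreeFamily G' → Op₅ G' G → TreeFamily G
  | op₆ {V W : Type u} {G' : SimpleGraph V} {G : SimpleGraph W} :
      TreeFamily G' → Op₆ G' G → TreeFamily G

end TwoDom

/-! Cut a graph into a rooted piece and a rest that meets the piece only at its root. Rest and piece
then interact only through whether the root is chosen and how many chosen neighbours the rest gives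
it. Hence the 2-domination and the 2-independence number of the whole depend on the piece only
through the seven numbers `Vals`: four minima (root to be dominated 0, 1 or 2 times from inside, or
chosen) and three maxima (root may see 0 or 1 chosen vertices outside, or is not chosen). If the
numbers of two pieces differ by a constant `k`, then exchanging the pieces changes both parameters
by `k` in every context, so equality is kept in both directions (`ctx_equal_iff_of_shift`). For
rooted trees the numbers follow a recursion (`vals_join`) and can be computed.

A PDI-subtree is precisely a piece whose only contact with the rest is its white vertex
(`OpData.rel_of_ctx`, `OpData.Rel.exists_ctx`). Each operation therefore exchanges one of twenty
pairs of rooted pieces (`rules`), and each pair differs by a shift (`rules_eval`). So equality holds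
throughout the family, as it holds for trees of order at most 4.

For the converse, a tree with equality and order above 4 has to be reducible by a rule; induction on
the order then applies. The obstruction is the excess, the minimum of `i0 - d2`, `i1 - d1` and `i2 -
d0`: it is nonnegative and superadditive under joins, and it is at most the difference of the two
parameters. With equality, every branch thus has excess 0. Irreducible rooted trees of excess 0 are
built from branches of the same kind, and a finite check on pairs (`terminal_join`) shows that
sixteen of them exhaust all cases (`classification`). Those of order above 4 with equality become
reducible when the root moves to a neighbour (`terminal_small_or`). -/

namespace TwoDom

open Set

/-! ### Rooted domination and independence values -/

/-- Number of neighbours of `v` in `S`. -/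
noncomputable abbrev nbrs {V : Type*} (G : SimpleGraph V) (S : Set V) (v : V) : ℕ :=
  (G.neighborSet v ∩ S).ncard

/-- Every vertex other than the root is 2-dominated by `S`, and the root lies in `S` or has at
least `l ≤ 2` neighbours in `S`. Level `3` means that the root lies in `S`. -/
def DomLevel {V : Type*} (G : SimpleGraph V) (r : V) (l : ℕ) (S : Set V) : Prop :=
  (∀ v, v ∉ S → v ≠ r → 2 ≤ nbrs G S v) ∧ (r ∉ S → l ≤ nbrs G S r ∧ l ≤ 2)

/-- Every vertex of `S` other than the root has at most one neighbour in `S`, and the root, if it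
lies in `S`, has at most `1 - l` neighbours in `S`. Level `2` means that the root avoids `S`. -/
def IndLevel {V : Type*} (G : SimpleGraph V) (r : V) (l : ℕ) (S : Set V) : Prop :=
  (∀ v, v ∈ S → v ≠ r → nbrs G S v ≤ 1) ∧ (r ∈ S → nbrs G S r + l ≤ 1)

/-- Minimum size of a set of domination level `l`. -/
noncomputable def domVal {V : Type*} (G : SimpleGraph V) (r : V) (l : ℕ) : ℕ :=
  sInf {n | ∃ S : Set V, DomLevel G r l S ∧ S.ncard = n}

/-- Maximum size of a set of independence level `l`. -/
noncomputable def indVal {V : Type*} (G : SimpleGraph V) (r : V) (l : ℕ) : ℕ :=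
  sSup {n | ∃ S : Set V, IndLevel G r l S ∧ S.ncard = n}

section Values

variable {V : Type*} {G : SimpleGraph V} {r : V} {l : ℕ} {S : Set V}

lemma domVal_le (h : DomLevel G r l S) : domVal G r l ≤ S.ncard := Nat.sInf_le ⟨S, h, rfl⟩

lemma exists_domVal (G : SimpleGraph V) (r : V) (l : ℕ) :
    ∃ S, DomLevel G r l S ∧ S.ncard = domVal G r l :=
  Nat.sInf_mem (s := {n | ∃ S : Set V, DomLevel G r l S ∧ S.ncard = n})
    ⟨_, univ, ⟨by simp, by simp⟩, rfl⟩

lemma indVal_bddAbove [Finite V] (G : SimpleGraph V) (r : V) (l : ℕ) :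
    BddAbove {n | ∃ S : Set V, IndLevel G r l S ∧ S.ncard = n} := by
  refine ⟨Nat.card V, ?_⟩
  rintro n ⟨S, -, rfl⟩
  rw [← ncard_univ]
  exact ncard_le_ncard (subset_univ S)

lemma le_indVal [Finite V] (h : IndLevel G r l S) : S.ncard ≤ indVal G r l :=
  le_csSup (indVal_bddAbove G r l) ⟨S, h, rfl⟩

lemma exists_indVal [Finite V] (G : SimpleGraph V) (r : V) (l : ℕ) :
    ∃ S, IndLevel G r l S ∧ S.ncard = indVal G r l :=
  Nat.sSup_mem (s := {n | ∃ S : Set V, IndLevel G r l S ∧ S.ncard = n})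
    ⟨_, ∅, ⟨by simp, by simp⟩, rfl⟩ (indVal_bddAbove G r l)

/-- At level 2 the root obeys the same condition as every other vertex. So the root may be chosen at
will, which later permits re-rooting. -/
lemma kDominationNumber_eq_domVal {V : Type u} (G : SimpleGraph V) (r : V) :
    kDominationNumber G 2 = domVal G r 2 := by
  have h (S : Set V) : IsKDominating G 2 S ↔ DomLevel G r 2 S := by
    refine ⟨fun h => ⟨fun v hv _ => h v hv, fun hr => ⟨h r hr, le_rfl⟩⟩, fun h v hv => ?_⟩
    by_cases hvr : v = r
    · subst hvr; exact (h.2 hv).1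
    · exact h.1 v hv hvr
  simp [kDominationNumber, domVal, h]

lemma kIndependenceNumber_eq_indVal {V : Type u} (G : SimpleGraph V) (r : V) :
    kIndependenceNumber G 2 = indVal G r 0 := by
  have h (S : Set V) : IsKIndependent G 2 S ↔ IndLevel G r 0 S := by
    refine ⟨fun h => ⟨fun v hv _ => Nat.lt_succ_iff.1 (h v hv),
      fun hr => Nat.lt_succ_iff.1 (h r hr)⟩, fun h v hv => Nat.lt_succ_iff.2 ?_⟩
    by_cases hvr : v = r
    · subst hvr; exact h.2 hv
    · exact h.1 v hv hvr
  simp [kIndependenceNumber, indVal, h]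

lemma DomLevel.mono {k : ℕ} (h : DomLevel G r l S) (hk : k ≤ l) : DomLevel G r k S :=
  ⟨h.1, fun hr => ⟨hk.trans (h.2 hr).1, hk.trans (h.2 hr).2⟩⟩

lemma IndLevel.mono {k : ℕ} (h : IndLevel G r l S) (hk : k ≤ l) : IndLevel G r k S :=
  ⟨h.1, fun hr => (Nat.add_le_add_left hk _).trans (h.2 hr)⟩

lemma domLevel_of_mem {k : ℕ} (h : DomLevel G r l S) (hr : r ∈ S) : DomLevel G r k S :=
  ⟨h.1, fun h' => (h' hr).elim⟩

lemma indLevel_of_notMem {k : ℕ} (h : IndLevel G r l S) (hr : r ∉ S) : IndLevel G r k S :=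
  ⟨h.1, fun h' => (hr h').elim⟩

lemma DomLevel.mem (h : DomLevel G r 3 S) : r ∈ S := by
  by_contra hr
  have := (h.2 hr).2
  omega

lemma IndLevel.notMem (h : IndLevel G r l S) (hl : 2 ≤ l) : r ∉ S := fun hr => by
  have := h.2 hr
  omega

lemma domVal_mono {k : ℕ} (hk : k ≤ l) : domVal G r k ≤ domVal G r l := by
  obtain ⟨S, hS, h⟩ := exists_domVal G r l
  exact h ▸ domVal_le (hS.mono hk)

end Values

section Iso

variable {V W : Type*} {G : SimpleGraph V} {H : SimpleGraph W}

lemma nbrs_image (φ : G ≃g H) (S : Set V) (v : V) : nbrs H (φ '' S) (φ v) = nbrs G S v := by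
  have : H.neighborSet (φ v) ∩ φ '' S = φ '' (G.neighborSet v ∩ S) := by
    ext w
    obtain ⟨x, rfl⟩ := φ.surjective w
    simp [φ.map_adj_iff]
  rw [nbrs, this, ncard_image_of_injective _ φ.injective]

lemma DomLevel.image {r : V} {l : ℕ} {S : Set V} (φ : G ≃g H) (h : DomLevel G r l S) :
    DomLevel H (φ r) l (φ '' S) := by
  refine ⟨fun w hw hr => ?_, fun hr => ?_⟩
  · obtain ⟨v, rfl⟩ := φ.surjective w
    rw [nbrs_image]
    exact h.1 v (by simpa using hw) (by simpa using hr)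
  · rw [nbrs_image]
    exact h.2 (by simpa using hr)

lemma IndLevel.image {r : V} {l : ℕ} {S : Set V} (φ : G ≃g H) (h : IndLevel G r l S) :
    IndLevel H (φ r) l (φ '' S) := by
  refine ⟨fun w hw hr => ?_, fun hr => ?_⟩
  · obtain ⟨v, rfl⟩ := φ.surjective w
    rw [nbrs_image]
    exact h.1 v (by simpa using hw) (by simpa using hr)
  · rw [nbrs_image]
    exact h.2 (by simpa using hr)

lemma domVal_iso (φ : G ≃g H) (r : V) (l : ℕ) : domVal H (φ r) l = domVal G r l := by
  apply le_antisymm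
  · obtain ⟨S, hS, h⟩ := exists_domVal G r l
    rw [← h, ← ncard_image_of_injective S φ.injective]
    exact domVal_le (hS.image φ)
  · obtain ⟨S, hS, h⟩ := exists_domVal H (φ r) l
    rw [← h, ← ncard_image_of_injective S φ.symm.injective]
    exact domVal_le (by simpa using hS.image φ.symm)

lemma indVal_iso [Finite V] (φ : G ≃g H) (r : V) (l : ℕ) : indVal H (φ r) l = indVal G r l := by
  have := Finite.of_equiv V φ.toEquiv
  apply le_antisymm
  · obtain ⟨S, hS, h⟩ := exists_indVal H (φ r) l
    rw [← h, ← ncard_image_of_injective S φ.symm.injective]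
    exact le_indVal (by simpa using hS.image φ.symm)
  · obtain ⟨S, hS, h⟩ := exists_indVal G r l
    rw [← h, ← ncard_image_of_injective S φ.injective]
    exact le_indVal (hS.image φ)

end Iso

/-! ### Rooted graphs in a context -/

/-- The rooted graph `(a, r)` and the graph `L`, with the root joined to all vertices in `N`. -/
def ctx {A Y : Type*} (a : SimpleGraph A) (r : A) (L : SimpleGraph Y) (N : Set Y) :
    SimpleGraph (A ⊕ Y) where
  Adj
    | .inl x, .inl y => a.Adj x y
    | .inl x, .inr y => x = r ∧ y ∈ N
    | .inr y, .inl x => x = r ∧ y ∈ N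
    | .inr x, .inr y => L.Adj x y
  symm := ⟨by
    rintro (x | x) (y | y) h
    · exact a.adj_symm h
    · exact h
    · exact h
    · exact L.adj_symm h⟩
  loopless := ⟨by
    rintro (x | x) h
    · exact a.irrefl h
    · exact L.irrefl h⟩

/-- `T` is 2-dominating in `L`, given one more neighbour for the vertices in `N` if `P` holds. -/
def CtxDom {Y : Type*} (L : SimpleGraph Y) (N : Set Y) (P : Prop) (T : Set Y) : Prop :=
  ∀ y, y ∉ T → 2 ≤ nbrs L T y + {z | z = y ∧ z ∈ N ∧ P}.ncard

/-- `T` is 2-independent in `L`, given one more neighbour for the vertices in `N` if `P` holds. -/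
def CtxInd {Y : Type*} (L : SimpleGraph Y) (N : Set Y) (P : Prop) (T : Set Y) : Prop :=
  ∀ y, y ∈ T → nbrs L T y + {z | z = y ∧ z ∈ N ∧ P}.ncard ≤ 1

section Context

variable {A Y : Type*} {a : SimpleGraph A} {r : A} {L : SimpleGraph Y} {N : Set Y}

@[simp] lemma ctx_inl_inl {x y : A} : (ctx a r L N).Adj (.inl x) (.inl y) ↔ a.Adj x y := Iff.rfl
@[simp] lemma ctx_inl_inr {x : A} {y : Y} :
    (ctx a r L N).Adj (.inl x) (.inr y) ↔ x = r ∧ y ∈ N := Iff.rfl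
@[simp] lemma ctx_inr_inl {x : A} {y : Y} :
    (ctx a r L N).Adj (.inr y) (.inl x) ↔ x = r ∧ y ∈ N := Iff.rfl
@[simp] lemma ctx_inr_inr {x y : Y} : (ctx a r L N).Adj (.inr x) (.inr y) ↔ L.Adj x y := Iff.rfl

/-- The union of a set of left vertices and a set of right vertices. -/
abbrev sumSet (S : Set A) (T : Set Y) : Set (A ⊕ Y) := Sum.inl '' S ∪ Sum.inr '' T

lemma exists_eq_sumSet (U : Set (A ⊕ Y)) : ∃ S T, U = sumSet S T :=
  ⟨Sum.inl ⁻¹' U, Sum.inr ⁻¹' U, (image_preimage_inl_union_image_preimage_inr U).symm⟩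

lemma ncard_sumSet [Finite A] [Finite Y] (S : Set A) (T : Set Y) :
    (sumSet S T).ncard = S.ncard + T.ncard := by
  rw [sumSet, ncard_union_eq (by simp [disjoint_left]),
    ncard_image_of_injective _ Sum.inl_injective, ncard_image_of_injective _ Sum.inr_injective]

lemma nbrs_ctx_inl (S : Set A) (T : Set Y) {x : A} (hx : x ≠ r) :
    nbrs (ctx a r L N) (sumSet S T) (.inl x) = nbrs a S x := by
  rw [nbrs, nbrs, ← ncard_image_of_injective (a.neighborSet x ∩ S) (Sum.inl_injective (β := Y))]
  congr 1
  ext (y | y) <;> simp [hx]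

variable [Finite A] [Finite Y]

lemma nbrs_ctx_root (S : Set A) (T : Set Y) :
    nbrs (ctx a r L N) (sumSet S T) (.inl r) = nbrs a S r + (N ∩ T).ncard := by
  rw [nbrs, ← ncard_sumSet]
  congr 1
  ext (x | x) <;> simp

lemma nbrs_ctx_inr (S : Set A) (T : Set Y) (y : Y) :
    nbrs (ctx a r L N) (sumSet S T) (.inr y) =
      nbrs L T y + {z | z = y ∧ z ∈ N ∧ r ∈ S}.ncard := by
  by_cases h : y ∈ N ∧ r ∈ S
  · have h1 : {z | z = y ∧ z ∈ N ∧ r ∈ S} = {y} := by ext z; simp; rintro rfl; exact h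
    rw [h1, nbrs, ncard_singleton, add_comm, ← ncard_singleton r, ← ncard_sumSet]
    congr 1
    ext (x | x) <;> simp
    constructor
    · rintro ⟨⟨rfl, -⟩, -⟩; rfl
    · rintro rfl; exact ⟨⟨rfl, h.1⟩, h.2⟩
  · have h1 : {z | z = y ∧ z ∈ N ∧ r ∈ S} = ∅ := by
      ext z; simp only [mem_ofPred_eq, mem_empty_iff_false, iff_false]; rintro ⟨rfl, h'⟩; exact h h'
    rw [h1, nbrs, nbrs, ncard_empty, add_zero,
      ← ncard_image_of_injective (L.neighborSet y ∩ T) (Sum.inr_injective (α := A))]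
    congr 1
    ext (x | x) <;> simp
    rintro rfl h2 h3
    exact h ⟨h2, h3⟩

/-- Chosen vertices of `N` lower the demand on the piece, hence the truncated subtraction. At level
3 it would lose the condition that the root is chosen; the disjunction restores it. -/
lemma domLevel_ctx_iff {l : ℕ} {S : Set A} {T : Set Y} :
    DomLevel (ctx a r L N) (.inl r) l (sumSet S T) ↔
      DomLevel a r (l - (N ∩ T).ncard) S ∧ (l ≤ 2 ∨ r ∈ S) ∧ CtxDom L N (r ∈ S) T := by
  constructor
  · rintro ⟨h1, h2⟩
    refine ⟨⟨fun v hv hvr => ?_, fun hr => ?_⟩, ?_, fun y hy => ?_⟩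
    · rw [← nbrs_ctx_inl (L := L) (N := N) S T hvr]
      exact h1 _ (by simpa using hv) (by simpa using hvr)
    · have := h2 (by simpa using hr)
      rw [nbrs_ctx_root] at this
      omega
    · by_cases hr : r ∈ S
      · exact .inr hr
      · exact .inl (h2 (by simpa using hr)).2
    · rw [← nbrs_ctx_inr (a := a)]
      exact h1 _ (by simpa using hy) (by simp)
  · rintro ⟨⟨h1, h2⟩, h3, h4⟩
    refine ⟨?_, fun hr => ?_⟩
    · rintro (x | y) hv hvr
      · have hx : x ≠ r := by rintro rfl; exact hvr rfl
        rw [nbrs_ctx_inl _ _ hx]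
        exact h1 x (by simpa using hv) hx
      · rw [nbrs_ctx_inr]
        exact h4 y (by simpa using hv)
    · have hr' : r ∉ S := by simpa using hr
      have := h2 hr'
      rw [nbrs_ctx_root]
      exact ⟨by omega, h3.resolve_right hr'⟩

lemma indLevel_ctx_iff {l : ℕ} {S : Set A} {T : Set Y} :
    IndLevel (ctx a r L N) (.inl r) l (sumSet S T) ↔
      IndLevel a r (l + (N ∩ T).ncard) S ∧ CtxInd L N (r ∈ S) T := by
  constructor
  · rintro ⟨h1, h2⟩
    refine ⟨⟨fun v hv hvr => ?_, fun hr => ?_⟩, fun y hy => ?_⟩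
    · rw [← nbrs_ctx_inl (L := L) (N := N) S T hvr]
      exact h1 _ (by simpa using hv) (by simpa using hvr)
    · have := h2 (by simpa using hr)
      rw [nbrs_ctx_root] at this
      omega
    · rw [← nbrs_ctx_inr (a := a)]
      exact h1 _ (by simpa using hy) (by simp)
  · rintro ⟨⟨h1, h2⟩, h4⟩
    refine ⟨?_, fun hr => ?_⟩
    · rintro (x | y) hv hvr
      · have hx : x ≠ r := by rintro rfl; exact hvr rfl
        rw [nbrs_ctx_inl _ _ hx]
        exact h1 x (by simpa using hv) hx
      · rw [nbrs_ctx_inr]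
        exact h4 y (by simpa using hv)
    · have := h2 (by simpa using hr)
      rw [nbrs_ctx_root]
      omega

lemma CtxDom.mono {P Q : Prop} {T : Set Y} (h : CtxDom L N P T) (hPQ : P → Q) :
    CtxDom L N Q T := fun y hy => (h y hy).trans <| Nat.add_le_add_left
      (ncard_le_ncard (show {z | z = y ∧ z ∈ N ∧ P} ⊆ {z | z = y ∧ z ∈ N ∧ Q} from
        fun _ hz => ⟨hz.1, hz.2.1, hPQ hz.2.2⟩)) _

lemma CtxInd.mono {P Q : Prop} {T : Set Y} (h : CtxInd L N P T) (hPQ : Q → P) :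
    CtxInd L N Q T := fun y hy => le_trans (Nat.add_le_add_left
      (ncard_le_ncard (show {z | z = y ∧ z ∈ N ∧ Q} ⊆ {z | z = y ∧ z ∈ N ∧ P} from
        fun _ hz => ⟨hz.1, hz.2.1, hPQ hz.2.2⟩)) _) (h y hy)

variable {A' : Type*} [Finite A'] {a' : SimpleGraph A'} {r' : A'}

/-- Exchange argument: in an optimal set of the one context, the part inside the piece is replaced
by an optimal set of the other piece at the same level, while the part `T` in the rest stays. -/
lemma domVal_ctx_le (L : SimpleGraph Y) (N : Set Y) {m n : ℕ}
    (h : ∀ l ≤ 3, domVal a' r' l + m ≤ domVal a r l + n) :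
    domVal (ctx a' r' L N) (.inl r') 2 + m ≤ domVal (ctx a r L N) (.inl r) 2 + n := by
  obtain ⟨U, hU, hc⟩ := exists_domVal (ctx a r L N) (.inl r) 2
  obtain ⟨S, T, rfl⟩ := exists_eq_sumSet U
  obtain ⟨h1, -, h3⟩ := domLevel_ctx_iff.1 hU
  rw [ncard_sumSet] at hc
  have key (l : ℕ) (hl : l ≤ 3) (hS : DomLevel a r l S)
      (hl' : DomLevel a' r' l ≤ DomLevel a' r' (2 - (N ∩ T).ncard))
      (hr : ∀ X, DomLevel a' r' l X → r ∈ S → r' ∈ X) :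
      domVal (ctx a' r' L N) (.inl r') 2 + m ≤ domVal (ctx a r L N) (.inl r) 2 + n := by
    obtain ⟨X, hX, hXc⟩ := exists_domVal a' r' l
    have := domVal_le (domLevel_ctx_iff.2
      ⟨hl' X hX, .inl le_rfl, h3.mono (hr X hX)⟩ : DomLevel (ctx a' r' L N) _ _ (sumSet X T))
    rw [ncard_sumSet] at this
    have := domVal_le hS
    have := h l hl
    omega
  by_cases hr : r ∈ S
  · exact key 3 le_rfl (domLevel_of_mem h1 hr) (fun X hX => hX.mono (by omega))
      fun X hX _ => hX.mem
  · exact key _ (by omega) h1 le_rfl fun X hX h => (hr h).elim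

/-- The dual exchange: here a new root that appears in the set could harm `T`, whereas its absence
never does. -/
lemma indVal_ctx_le (L : SimpleGraph Y) (N : Set Y) {m n : ℕ}
    (h : ∀ l ≤ 2, indVal a r l + m ≤ indVal a' r' l + n) :
    indVal (ctx a r L N) (.inl r) 0 + m ≤ indVal (ctx a' r' L N) (.inl r') 0 + n := by
  obtain ⟨U, hU, hc⟩ := exists_indVal (ctx a r L N) (.inl r) 0
  obtain ⟨S, T, rfl⟩ := exists_eq_sumSet U
  obtain ⟨h1, h3⟩ := indLevel_ctx_iff.1 hU
  rw [ncard_sumSet] at hc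
  have key (l : ℕ) (hl : l ≤ 2) (hS : IndLevel a r l S)
      (hl' : IndLevel a' r' l ≤ IndLevel a' r' (0 + (N ∩ T).ncard))
      (hr : ∀ X, IndLevel a' r' l X → r' ∈ X → r ∈ S) :
      indVal (ctx a r L N) (.inl r) 0 + m ≤ indVal (ctx a' r' L N) (.inl r') 0 + n := by
    obtain ⟨X, hX, hXc⟩ := exists_indVal a' r' l
    have := le_indVal (indLevel_ctx_iff.2
      ⟨hl' X hX, h3.mono (hr X hX)⟩ : IndLevel (ctx a' r' L N) _ _ (sumSet X T))
    rw [ncard_sumSet] at this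
    have := le_indVal hS
    have := h l hl
    omega
  -- If `r` is chosen, it tolerates at most one chosen vertex of `N`, so the level is at most 1. If
  -- not, level 2 keeps the new root out.
  by_cases hr : r ∈ S
  · refine key (0 + (N ∩ T).ncard) ?_ h1 le_rfl fun _ _ _ => hr
    have := h1.2 hr
    omega
  · exact key 2 le_rfl (indLevel_of_notMem h1 hr)
      (fun X hX => indLevel_of_notMem hX (hX.notMem le_rfl))
      fun X hX h => (hX.notMem le_rfl h).elim

end Context

/-! ### Joining two rooted graphs -/

section Join

variable {A B : Type*} {a : SimpleGraph A} {r : A} {b : SimpleGraph B} {s : B}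

lemma ncard_singleton_inter_of_mem {T : Set B} (h : s ∈ T) : (({s} : Set B) ∩ T).ncard = 1 := by
  rw [inter_eq_left.2 (by simpa using h), ncard_singleton]

lemma ncard_singleton_inter_of_notMem {T : Set B} (h : s ∉ T) :
    (({s} : Set B) ∩ T).ncard = 0 := by
  rw [singleton_inter_eq_empty.2 h, ncard_empty]

lemma ncard_extra_of_ne {P : Prop} {y : B} (h : y ≠ s) :
    {z | z = y ∧ z ∈ ({s} : Set B) ∧ P}.ncard = 0 := by
  rw [show {z | z = y ∧ z ∈ ({s} : Set B) ∧ P} = ∅ from ?_, ncard_empty]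
  ext z
  simp only [mem_ofPred_eq, mem_singleton_iff, mem_empty_iff_false, iff_false]
  rintro ⟨rfl, rfl, -⟩
  exact h rfl

lemma ncard_extra_of_not {P : Prop} {y : B} (h : ¬ P) :
    {z | z = y ∧ z ∈ ({s} : Set B) ∧ P}.ncard = 0 := by
  simp [h]

lemma ncard_extra_root {P : Prop} (h : P) : {z | z = s ∧ z ∈ ({s} : Set B) ∧ P}.ncard = 1 := by
  rw [show {z | z = s ∧ z ∈ ({s} : Set B) ∧ P} = {s} from ?_, ncard_singleton]
  ext z
  simp [h]

lemma ctxDom_singleton_iff_of_true {P : Prop} (h : P) {T : Set B} :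
    CtxDom b {s} P T ↔ DomLevel b s 1 T := by
  constructor
  · intro hT
    refine ⟨fun v hv hvs => ?_, fun hs => ?_⟩
    · have := hT v hv
      rwa [ncard_extra_of_ne hvs] at this
    · have := hT s hs
      rw [ncard_extra_root h] at this
      omega
  · rintro ⟨h1, h2⟩ y hy
    by_cases hys : y = s
    · subst hys
      have := h2 hy
      rw [ncard_extra_root h]
      omega
    · exact (h1 y hy hys).trans (Nat.le_add_right _ _)

lemma ctxDom_singleton_iff_of_false {P : Prop} (h : ¬ P) {T : Set B} :
    CtxDom b {s} P T ↔ DomLevel b s 2 T := by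
  constructor
  · intro hT
    refine ⟨fun v hv _ => ?_, fun hs => ?_⟩
    · have := hT v hv
      rwa [ncard_extra_of_not h] at this
    · have := hT s hs
      rw [ncard_extra_of_not h] at this
      omega
  · rintro ⟨h1, h2⟩ y hy
    by_cases hys : y = s
    · subst hys
      have := h2 hy
      omega
    · exact (h1 y hy hys).trans (Nat.le_add_right _ _)

lemma ctxInd_singleton_iff_of_true {P : Prop} (h : P) {T : Set B} :
    CtxInd b {s} P T ↔ IndLevel b s 1 T := by
  constructor
  · intro hT
    refine ⟨fun v hv hvs => ?_, fun hs => ?_⟩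
    · have := hT v hv
      rwa [ncard_extra_of_ne hvs] at this
    · have := hT s hs
      rwa [ncard_extra_root h] at this
  · rintro ⟨h1, h2⟩ y hy
    by_cases hys : y = s
    · subst hys
      have := h2 hy
      rwa [ncard_extra_root h]
    · rw [ncard_extra_of_ne hys]
      exact h1 y hy hys

lemma ctxInd_singleton_iff_of_false {P : Prop} (h : ¬ P) {T : Set B} :
    CtxInd b {s} P T ↔ IndLevel b s 0 T := by
  constructor
  · intro hT
    refine ⟨fun v hv _ => ?_, fun hs => ?_⟩
    · have := hT v hv
      rwa [ncard_extra_of_not h] at this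
    · have := hT s hs
      rwa [ncard_extra_of_not h] at this
  · rintro ⟨h1, h2⟩ y hy
    rw [ncard_extra_of_not h]
    by_cases hys : y = s
    · subst hys
      exact h2 hy
    · exact h1 y hy hys

variable [Finite A] [Finite B]

lemma domVal_join_le_of_mem (l : ℕ) :
    domVal (ctx a r b {s}) (.inl r) l ≤ domVal a r 3 + domVal b s 1 := by
  obtain ⟨S, hS, hS'⟩ := exists_domVal a r 3
  obtain ⟨T, hT, hT'⟩ := exists_domVal b s 1
  rw [← hS', ← hT', ← ncard_sumSet]
  exact domVal_le (domLevel_ctx_iff.2 ⟨domLevel_of_mem hS hS.mem, .inr hS.mem,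
    (ctxDom_singleton_iff_of_true hS.mem).2 hT⟩)

lemma domVal_join_le {l : ℕ} (hl : l ≤ 2) :
    domVal (ctx a r b {s}) (.inl r) l ≤ domVal a r l + domVal b s 2 := by
  obtain ⟨S, hS, hS'⟩ := exists_domVal a r l
  obtain ⟨T, hT, hT'⟩ := exists_domVal b s 2
  rw [← hS', ← hT', ← ncard_sumSet]
  exact domVal_le (domLevel_ctx_iff.2 ⟨hS.mono (Nat.sub_le _ _), .inl hl,
    ((ctxDom_singleton_iff_of_false (P := False) id).2 hT).mono False.elim⟩)

lemma domVal_join_le' {l : ℕ} (hl : l ≤ 1) :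
    domVal (ctx a r b {s}) (.inl r) (l + 1) ≤ domVal a r l + domVal b s 3 := by
  obtain ⟨S, hS, hS'⟩ := exists_domVal a r l
  obtain ⟨T, hT, hT'⟩ := exists_domVal b s 3
  rw [← hS', ← hT', ← ncard_sumSet]
  refine domVal_le (domLevel_ctx_iff.2 ⟨?_, .inl (by omega),
    ((ctxDom_singleton_iff_of_false (P := False) id).2 (hT.mono (by omega))).mono False.elim⟩)
  rwa [ncard_singleton_inter_of_mem hT.mem]

/-- The alternatives are: `r` chosen, which gives `s` one neighbour; neither root chosen; only `s`
chosen, which lowers the demand on `r` by one. -/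
lemma le_domVal_join (l : ℕ) :
    domVal a r 3 + domVal b s 1 ≤ domVal (ctx a r b {s}) (.inl r) l ∨
    l ≤ 2 ∧ (domVal a r l + domVal b s 2 ≤ domVal (ctx a r b {s}) (.inl r) l ∨
      domVal a r (l - 1) + domVal b s 3 ≤ domVal (ctx a r b {s}) (.inl r) l) := by
  obtain ⟨U, hU, hc⟩ := exists_domVal (ctx a r b {s}) (.inl r) l
  obtain ⟨S, T, rfl⟩ := exists_eq_sumSet U
  obtain ⟨h1, h2, h3⟩ := domLevel_ctx_iff.1 hU
  rw [ncard_sumSet] at hc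
  rw [← hc]
  by_cases hr : r ∈ S
  · left
    exact add_le_add (domVal_le (domLevel_of_mem h1 hr))
      (domVal_le ((ctxDom_singleton_iff_of_true hr).1 h3))
  · have hT := (ctxDom_singleton_iff_of_false hr).1 h3
    refine .inr ⟨h2.resolve_right hr, ?_⟩
    by_cases hs : s ∈ T
    · right
      rw [ncard_singleton_inter_of_mem hs] at h1
      exact add_le_add (domVal_le h1) (domVal_le (domLevel_of_mem hT hs))
    · left
      rw [ncard_singleton_inter_of_notMem hs] at h1
      exact add_le_add (domVal_le h1) (domVal_le hT)

lemma indVal_le_join_of_notMem (l : ℕ) :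
    indVal a r 2 + indVal b s 0 ≤ indVal (ctx a r b {s}) (.inl r) l := by
  obtain ⟨S, hS, hS'⟩ := exists_indVal a r 2
  obtain ⟨T, hT, hT'⟩ := exists_indVal b s 0
  rw [← hS', ← hT', ← ncard_sumSet]
  have hr := hS.notMem le_rfl
  exact le_indVal (indLevel_ctx_iff.2 ⟨indLevel_of_notMem hS hr,
    (ctxInd_singleton_iff_of_false hr).2 hT⟩)

lemma indVal_le_join (l : ℕ) :
    indVal a r l + indVal b s 2 ≤ indVal (ctx a r b {s}) (.inl r) l := by
  obtain ⟨S, hS, hS'⟩ := exists_indVal a r l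
  obtain ⟨T, hT, hT'⟩ := exists_indVal b s 2
  rw [← hS', ← hT', ← ncard_sumSet]
  refine le_indVal (indLevel_ctx_iff.2 ⟨?_,
    ((ctxInd_singleton_iff_of_true trivial).2 (hT.mono (by omega))).mono fun _ => trivial⟩)
  rwa [ncard_singleton_inter_of_notMem (hT.notMem le_rfl)]

lemma indVal_le_join' (l : ℕ) :
    indVal a r (l + 1) + indVal b s 1 ≤ indVal (ctx a r b {s}) (.inl r) l := by
  obtain ⟨S, hS, hS'⟩ := exists_indVal a r (l + 1)
  obtain ⟨T, hT, hT'⟩ := exists_indVal b s 1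
  rw [← hS', ← hT', ← ncard_sumSet]
  refine le_indVal (indLevel_ctx_iff.2 ⟨hS.mono ?_,
    ((ctxInd_singleton_iff_of_true trivial).2 hT).mono fun _ => trivial⟩)
  by_cases hs : s ∈ T
  · rw [ncard_singleton_inter_of_mem hs]
  · rw [ncard_singleton_inter_of_notMem hs]
    omega

lemma indVal_join_le (l : ℕ) :
    indVal (ctx a r b {s}) (.inl r) l ≤ indVal a r 2 + indVal b s 0 ∨
    l ≤ 1 ∧ indVal (ctx a r b {s}) (.inl r) l ≤ indVal a r l + indVal b s 2 ∨
    l = 0 ∧ indVal (ctx a r b {s}) (.inl r) l ≤ indVal a r (l + 1) + indVal b s 1 := by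
  obtain ⟨U, hU, hc⟩ := exists_indVal (ctx a r b {s}) (.inl r) l
  obtain ⟨S, T, rfl⟩ := exists_eq_sumSet U
  obtain ⟨h1, h3⟩ := indLevel_ctx_iff.1 hU
  rw [ncard_sumSet] at hc
  rw [← hc]
  by_cases hr : r ∈ S
  · have hT := (ctxInd_singleton_iff_of_true hr).1 h3
    have hl := h1.2 hr
    by_cases hs : s ∈ T
    · rw [ncard_singleton_inter_of_mem hs] at h1 hl
      exact .inr (.inr ⟨by omega, add_le_add (le_indVal h1) (le_indVal hT)⟩)
    · rw [ncard_singleton_inter_of_notMem hs] at h1 hl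
      exact .inr (.inl ⟨by omega, add_le_add (le_indVal h1)
        (le_indVal (indLevel_of_notMem hT hs))⟩)
  · left
    exact add_le_add (le_indVal (indLevel_of_notMem h1 hr))
      (le_indVal ((ctxInd_singleton_iff_of_false hr).1 h3))

end Join

/-! ### Values of rooted graphs, and their behaviour under joins -/

/-- The domination values at levels `0, 1, 2, 3` and the independence values at levels
`0, 1, 2`. -/
structure Vals where
  (d0 d1 d2 d3 i0 i1 i2 : ℕ)
deriving DecidableEq

/-- The values of a rooted graph. -/
noncomputable def vals {V : Type*} (G : SimpleGraph V) (r : V) : Vals :=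
  ⟨domVal G r 0, domVal G r 1, domVal G r 2, domVal G r 3,
    indVal G r 0, indVal G r 1, indVal G r 2⟩

/-- The values of a join in terms of the values of the two rooted graphs. -/
def Vals.comb (x y : Vals) : Vals where
  d0 := min (x.d0 + y.d2) (x.d3 + y.d1)
  d1 := min (min (x.d1 + y.d2) (x.d0 + y.d3)) (x.d3 + y.d1)
  d2 := min (min (x.d2 + y.d2) (x.d1 + y.d3)) (x.d3 + y.d1)
  d3 := x.d3 + y.d1
  i0 := max (max (x.i2 + y.i0) (x.i1 + y.i2)) (max (x.i0 + y.i2) (x.i1 + y.i1))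
  i1 := max (x.i2 + y.i0) (x.i1 + y.i2)
  i2 := x.i2 + y.i0

lemma vals_join {A B : Type*} [Finite A] [Finite B] (a : SimpleGraph A) (r : A)
    (b : SimpleGraph B) (s : B) :
    vals (ctx a r b {s}) (.inl r) = (vals a r).comb (vals b s) := by
  -- At level 0 the case where only `s` is chosen has cost `d0 + d3`; this inequality makes it
  -- redundant, and `comb` omits it.
  have hb := domVal_mono (G := b) (r := s) (show 2 ≤ 3 by omega)
  -- The maximum for `i0` in `comb` also lists `x.i1 + y.i2`, which is dominated by `x.i0 + y.i2`.
  have hi0 : indVal a r 1 ≤ indVal a r 0 := by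
    obtain ⟨S, hS, h⟩ := exists_indVal a r 1
    exact h ▸ le_indVal (hS.mono (by omega))
  simp only [vals, Vals.comb, Vals.mk.injEq]
  refine ⟨?_, ?_, ?_, ?_, ?_, ?_, ?_⟩
  · have h1 := domVal_join_le_of_mem (a := a) (r := r) (b := b) (s := s) 0
    have h2 := domVal_join_le (a := a) (r := r) (b := b) (s := s) (l := 0) (by omega)
    have h3 := le_domVal_join (a := a) (r := r) (b := b) (s := s) 0
    simp only [Nat.zero_sub] at h3
    omega
  · have h1 := domVal_join_le_of_mem (a := a) (r := r) (b := b) (s := s) 1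
    have h2 := domVal_join_le (a := a) (r := r) (b := b) (s := s) (l := 1) (by omega)
    have h2' := domVal_join_le' (a := a) (r := r) (b := b) (s := s) (l := 0) (by omega)
    have h3 := le_domVal_join (a := a) (r := r) (b := b) (s := s) 1
    simp only [zero_add, Nat.sub_self] at h3 h2'
    omega
  · have h1 := domVal_join_le_of_mem (a := a) (r := r) (b := b) (s := s) 2
    have h2 := domVal_join_le (a := a) (r := r) (b := b) (s := s) (l := 2) (by omega)
    have h2' := domVal_join_le' (a := a) (r := r) (b := b) (s := s) (l := 1) (by omega)
    have h3 := le_domVal_join (a := a) (r := r) (b := b) (s := s) 2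
    simp only [Nat.reduceAdd, Nat.reduceSub] at h3 h2'
    omega
  · have h1 := domVal_join_le_of_mem (a := a) (r := r) (b := b) (s := s) 3
    have h3 := le_domVal_join (a := a) (r := r) (b := b) (s := s) 3
    omega
  · have h1 := indVal_le_join_of_notMem (a := a) (r := r) (b := b) (s := s) 0
    have h2 := indVal_le_join (a := a) (r := r) (b := b) (s := s) 0
    have h2' := indVal_le_join' (a := a) (r := r) (b := b) (s := s) 0
    have h3 := indVal_join_le (a := a) (r := r) (b := b) (s := s) 0
    simp only [zero_add] at h3 h2'
    omega
  · have h1 := indVal_le_join_of_notMem (a := a) (r := r) (b := b) (s := s) 1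
    have h2 := indVal_le_join (a := a) (r := r) (b := b) (s := s) 1
    have h3 := indVal_join_le (a := a) (r := r) (b := b) (s := s) 1
    omega
  · have h1 := indVal_le_join_of_notMem (a := a) (r := r) (b := b) (s := s) 2
    have h3 := indVal_join_le (a := a) (r := r) (b := b) (s := s) 2
    omega

/-- Shift of all values by `k`. -/
def Vals.shift (x : Vals) (k : ℕ) : Vals :=
  ⟨x.d0 + k, x.d1 + k, x.d2 + k, x.d3 + k, x.i0 + k, x.i1 + k, x.i2 + k⟩

/-! ### Rooted trees -/

/-- Rooted trees: `join a b` arises from `a` by making the root of `b` a child of its root. -/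
inductive RTree
  | leaf : RTree
  | join : RTree → RTree → RTree
deriving DecidableEq

namespace RTree

/-- The vertex type. -/
def Vert : RTree → Type
  | leaf => Unit
  | join a b => a.Vert ⊕ b.Vert

/-- The root. -/
def root : (t : RTree) → t.Vert
  | leaf => ()
  | join a _ => Sum.inl a.root

/-- The underlying graph. -/
def graph : (t : RTree) → SimpleGraph t.Vert
  | leaf => ⊥
  | join a b => ctx a.graph a.root b.graph {b.root}

instance finite_vert : (t : RTree) → Finite t.Vert
  | leaf => inferInstanceAs (Finite Unit)
  | join a b =>
    have := finite_vert a
    have := finite_vert b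
    inferInstanceAs (Finite (a.Vert ⊕ b.Vert))

/-- Number of vertices. -/
def size : RTree → ℕ
  | leaf => 1
  | join a b => a.size + b.size

lemma card_vert : (t : RTree) → Nat.card t.Vert = t.size
  | leaf => Nat.card_unique (α := Unit)
  | join a b => by
    have := Nat.card_sum (α := a.Vert) (β := b.Vert)
    rwa [card_vert a, card_vert b] at this

/-- The values, computed by recursion. -/
def eval : RTree → Vals
  | leaf => ⟨0, 1, 1, 1, 1, 1, 0⟩
  | join a b => a.eval.comb b.eval

end RTree

lemma vals_bot_unit : vals (⊥ : SimpleGraph Unit) () = ⟨0, 1, 1, 1, 1, 1, 0⟩ := by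
  have h0 (S : Set Unit) : nbrs ⊥ S () = 0 := by simp [nbrs, SimpleGraph.neighborSet]
  have hu : (univ : Set Unit).ncard = 1 := by simp
  have hS (S : Set Unit) : () ∈ S → S = univ := fun h => by ext; simpa using h
  have hS' (S : Set Unit) : () ∉ S → S = ∅ := fun h => by ext; simpa using h
  have hd (l : ℕ) (hl : 1 ≤ l) : domVal (⊥ : SimpleGraph Unit) () l = 1 := by
    apply le_antisymm
    · exact hu ▸ domVal_le (S := univ) ⟨by simp, by simp⟩
    · obtain ⟨S, h, hc⟩ := exists_domVal (⊥ : SimpleGraph Unit) () l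
      rw [← hc, hS S, hu]
      by_contra hn
      have := h.2 hn
      rw [h0] at this
      omega
  have hi (l : ℕ) (hl : l ≤ 1) : indVal (⊥ : SimpleGraph Unit) () l = 1 := by
    apply le_antisymm
    · obtain ⟨S, h, hc⟩ := exists_indVal (⊥ : SimpleGraph Unit) () l
      rw [← hc, ← hu]
      exact ncard_le_ncard (subset_univ S)
    · rw [← hu]
      exact le_indVal ⟨by simp, fun _ => by rw [h0]; omega⟩
  simp only [vals, Vals.mk.injEq]
  refine ⟨?_, hd 1 le_rfl, hd 2 (by omega), hd 3 (by omega), hi 0 (by omega), hi 1 le_rfl, ?_⟩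
  · have := domVal_le (G := ⊥) (r := ()) (l := 0) (S := ∅) ⟨by simp, by simp⟩
    simpa using this
  · obtain ⟨S, h, hc⟩ := exists_indVal (⊥ : SimpleGraph Unit) () 2
    rw [← hc, hS' S (h.notMem le_rfl), ncard_empty]

lemma RTree.vals_eq_eval : (t : RTree) → vals t.graph t.root = t.eval
  | leaf => vals_bot_unit
  | join a b => by
    have := vals_join a.graph a.root b.graph b.root
    rwa [vals_eq_eval a, vals_eq_eval b] at this

/-! ### The excess -/

/-- A lower bound for the difference of the independence and the domination number of every graph
that contains the rooted graph as a branch. -/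
def Vals.excess (x : Vals) : ℤ :=
  min (x.i0 - x.d2 : ℤ) (min (x.i1 - x.d1) (x.i2 - x.d0))

/-- Order relations that hold for the values of every rooted tree. -/
def Vals.Regular (x : Vals) : Prop :=
  x.d0 ≤ x.d1 ∧ x.d1 ≤ x.d2 ∧ x.d2 ≤ x.d3 ∧ x.d3 ≤ x.d0 + 1 ∧
    x.i2 ≤ x.i1 ∧ x.i1 ≤ x.i0 ∧ x.i0 ≤ x.i2 + 1

lemma Vals.Regular.comb {x y : Vals} (hx : x.Regular) (hy : y.Regular) :
    (x.comb y).Regular := by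
  simp only [Vals.Regular, Vals.comb] at *
  omega

/-- Regularity confines `d0, ..., d3` to two consecutive values, so that neighbouring levels often
agree. For `i1 - d1`, say: if `y.d2 = y.d0`, compare `x.i1 + y.i2` with `x.d1 + y.d2`; otherwise
`y.d2 = y.d3`, and `x.i2 + y.i0` is compared with `x.d0 + y.d3`. The other two differences are
similar. -/
lemma Vals.excess_comb {x y : Vals} (hx : x.Regular) (hy : y.Regular) :
    x.excess + y.excess ≤ (x.comb y).excess := by
  have hx0 : x.excess ≤ x.i0 - x.d2 := min_le_left _ _
  have hx1 : x.excess ≤ x.i1 - x.d1 := (min_le_right _ _).trans (min_le_left _ _)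
  have hx2 : x.excess ≤ x.i2 - x.d0 := (min_le_right _ _).trans (min_le_right _ _)
  have hy0 : y.excess ≤ y.i0 - y.d2 := min_le_left _ _
  have hy1 : y.excess ≤ y.i1 - y.d1 := (min_le_right _ _).trans (min_le_left _ _)
  have hy2 : y.excess ≤ y.i2 - y.d0 := (min_le_right _ _).trans (min_le_right _ _)
  generalize x.excess = e at *
  generalize y.excess = f at *
  simp only [Vals.Regular] at hx hy
  refine le_min ?_ (le_min ?_ ?_) <;> simp only [Vals.comb] <;> omega

namespace RTree

lemma regular_eval : (t : RTree) → t.eval.Regular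
  | leaf => by simp [eval, Vals.Regular]
  | join a b => (regular_eval a).comb (regular_eval b)

lemma excess_nonneg : (t : RTree) → 0 ≤ t.eval.excess
  | leaf => by decide
  | join a b => (add_nonneg (excess_nonneg a) (excess_nonneg b)).trans
      (Vals.excess_comb (regular_eval a) (regular_eval b))

lemma excess_join (a b : RTree) : a.eval.excess + b.eval.excess ≤ (join a b).eval.excess :=
  Vals.excess_comb (regular_eval a) (regular_eval b)

end RTree

/-! ### Isomorphisms of contexts -/

section CtxIso

variable {A A' B Y Y' : Type*} {a : SimpleGraph A} {a' : SimpleGraph A'} {r : A} {r' : A'}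
  {L' : SimpleGraph Y'} {N' : Set Y'} {b : SimpleGraph B} {L : SimpleGraph Y} {N : Set Y}

/-- Contexts respect isomorphisms. -/
def ctxCongr (φ : a ≃g a') (hφ : φ r = r') (ψ : L ≃g L') (hψ : ∀ y, ψ y ∈ N' ↔ y ∈ N) :
    ctx a r L N ≃g ctx a' r' L' N' where
  toEquiv := Equiv.sumCongr φ.toEquiv ψ.toEquiv
  map_rel_iff' := by
    subst hφ
    rintro (x | x) (y | y) <;> simp [φ.map_adj_iff, ψ.map_adj_iff, hψ]

/-- Attaching a graph at the root of a rooted graph in a context enlarges the context. -/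
def ctxAssocRoot (a : SimpleGraph A) (r : A) (L : SimpleGraph Y) (N : Set Y) (b : SimpleGraph B)
    (M : Set B) :
    ctx (ctx a r L N) (.inl r) b M ≃g ctx a r (L ⊕g b) (Sum.inl '' N ∪ Sum.inr '' M) where
  toEquiv := Equiv.sumAssoc _ _ _
  map_rel_iff' := by
    rintro ((x | x) | x) ((y | y) | y) <;> simp

/-- Attaching a graph at a vertex of the context enlarges the context. -/
def ctxAssocRight (a : SimpleGraph A) (r : A) (L : SimpleGraph Y) (N : Set Y) (y : Y)
    (b : SimpleGraph B) (M : Set B) :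
    ctx (ctx a r L N) (.inr y) b M ≃g ctx a r (ctx L y b M) (Sum.inl '' N) where
  toEquiv := Equiv.sumAssoc _ _ _
  map_rel_iff' := by
    rintro ((x | x) | x) ((y | y) | y) <;> simp

/-- Two rooted graphs joined by an edge, in either order. -/
def ctxComm (a : SimpleGraph A) (r : A) (b : SimpleGraph B) (s : B) :
    ctx a r b {s} ≃g ctx b s a {r} where
  toEquiv := Equiv.sumComm _ _
  map_rel_iff' := by
    rintro (x | x) (y | y) <;> simp [and_comm]

/-- Attaching two graphs to a graph, in either order. -/
def ctxSwap {C : Type*} (a : SimpleGraph A) (r v : A) (b : SimpleGraph B)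
    (M : Set B) (c : SimpleGraph C) (N : Set C) :
    ctx (ctx a r b M) (.inl v) c N ≃g ctx (ctx a v c N) (.inl r) b M where
  toEquiv := (Equiv.sumAssoc _ _ _).trans
    (((Equiv.refl _).sumCongr (Equiv.sumComm _ _)).trans (Equiv.sumAssoc _ _ _).symm)
  map_rel_iff' := by
    rintro ((x | x) | x) ((y | y) | y) <;> simp

lemma ctx_singleton_eq (a : SimpleGraph A) (r : A)
    (b : SimpleGraph B) (s : B) :
    ctx a r b {s} = (a ⊕g b) ⊔ SimpleGraph.edge (.inl r) (.inr s) := by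
  ext (x | x) (y | y) <;> simp [SimpleGraph.edge_adj]
  exact and_comm

/-- The empty context. -/
def ctxEmpty (a : SimpleGraph A) (r : A) : a ≃g ctx a r (⊥ : SimpleGraph Empty) ∅ where
  toEquiv := (Equiv.sumEmpty A Empty).symm
  map_rel_iff' := by
    intro x y
    simp

end CtxIso

namespace RTree

/-! ### Isomorphism of rooted trees -/

/-- Isomorphism of rooted trees. -/
def RIso (s t : RTree) : Prop := ∃ φ : s.graph ≃g t.graph, φ s.root = t.root

lemma RIso.refl (t : RTree) : RIso t t := ⟨SimpleGraph.Iso.refl, rfl⟩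

lemma RIso.symm {s t : RTree} : RIso s t → RIso t s := fun ⟨φ, h⟩ => ⟨φ.symm, by simp [← h]⟩

lemma RIso.trans {s t v : RTree} : RIso s t → RIso t v → RIso s v :=
  fun ⟨φ, h⟩ ⟨ψ, h'⟩ => ⟨φ.trans ψ, by simp [h, h']⟩

lemma RIso.eval_eq {s t : RTree} : RIso s t → s.eval = t.eval := fun ⟨φ, h⟩ => by
  rw [← vals_eq_eval, ← vals_eq_eval, ← h]
  simp only [vals, domVal_iso, indVal_iso]

lemma RIso.join {s t s' t' : RTree} : RIso s s' → RIso t t' → RIso (s.join t) (s'.join t') :=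
  fun ⟨φ, h⟩ ⟨ψ, h'⟩ => ⟨ctxCongr φ h ψ (by simp [← h']), congrArg Sum.inl h⟩

lemma RIso.join_swap (a b c : RTree) : RIso ((a.join b).join c) ((a.join c).join b) :=
  ⟨ctxSwap a.graph a.root a.root b.graph {b.root} c.graph {c.root}, rfl⟩

/-- The branches at the root. -/
def children : RTree → List RTree
  | leaf => []
  | join a b => b :: a.children

/-- The rooted tree with the given branches at its root. -/
def ofList : List RTree → RTree
  | [] => leaf
  | b :: l => join (ofList l) b

lemma ofList_children : (t : RTree) → ofList t.children = t
  | leaf => rfl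
  | join a b => by rw [children, ofList, ofList_children a]

lemma RIso.of_perm {l l' : List RTree} (h : l.Perm l') : RIso (ofList l) (ofList l') := by
  induction h with
  | nil => exact RIso.refl _
  | cons x _ ih => exact ih.join (RIso.refl x)
  | swap x y l => exact RIso.join_swap _ _ _
  | trans _ _ ih₁ ih₂ => exact ih₁.trans ih₂

/-! ### Rewriting steps -/

/-- Replacing a branch according to one of the given rules. -/
inductive Step (R : List (RTree × RTree)) : RTree → RTree → Prop
  | base {p : RTree × RTree} : p ∈ R → Step R p.1 p.2
  | left {a a' : RTree} (b : RTree) : Step R a a' → Step R (join a b) (join a' b)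
  | right {b b' : RTree} (a : RTree) : Step R b b' → Step R (join a b) (join a b')
  | iso {a b c : RTree} : RIso a b → Step R b c → Step R a c

variable {R : List (RTree × RTree)}

lemma Step.ofList_append {a a' : RTree} (h : Step R a a') (l : List RTree) :
    ∃ t, Step R (ofList (l ++ a.children)) t := by
  induction l with
  | nil => exact ⟨a', by rwa [List.nil_append, ofList_children]⟩
  | cons b l ih =>
    obtain ⟨t, ht⟩ := ih
    exact ⟨_, ht.left b⟩

/-- The order of branches is irrelevant up to isomorphism. So the branches named by the rule can be
made the innermost ones, and the others are joined on afterwards. -/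
lemma exists_step_of_subperm {p : RTree × RTree} (hp : p ∈ R) {t : RTree}
    (h : p.1.children.Subperm t.children) : ∃ t', Step R t t' := by
  obtain ⟨l₀, h₀, hs⟩ := h
  obtain ⟨l, hl⟩ := hs.exists_perm_append
  obtain ⟨t', ht'⟩ := (Step.base hp).ofList_append l
  refine ⟨t', .iso ?_ ht'⟩
  have := RIso.of_perm (hl.trans ((h₀.append_right l).trans List.perm_append_comm))
  rwa [ofList_children] at this

/-- The pair `(t, t')` consists of the two sides of a rule placed in the same context. -/
lemma Step.exists_ctx {t t' : RTree} (h : Step R t t') :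
    ∃ p ∈ R, ∃ (Y : Type) (_ : Finite Y) (L : SimpleGraph Y) (N : Set Y)
      (φ : t.graph ≃g ctx p.1.graph p.1.root L N) (ψ : t'.graph ≃g ctx p.2.graph p.2.root L N),
      (φ t.root = .inl p.1.root ∧ ψ t'.root = .inl p.2.root) ∨
        ∃ y, φ t.root = .inr y ∧ ψ t'.root = .inr y := by
  -- The positions of the roots belong to the induction: a further branch can enter the common
  -- context only if it hangs at corresponding vertices on both sides.
  induction h with
  | @base p hp =>
    exact ⟨p, hp, Empty, inferInstance, ⊥, ∅, ctxEmpty _ _, ctxEmpty _ _, .inl ⟨rfl, rfl⟩⟩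
  | @left a a' b _ ih =>
    obtain ⟨p, hp, Y, _, L, N, φ, ψ, ⟨h1, h2⟩ | ⟨y, h1, h2⟩⟩ := ih
    · refine ⟨p, hp, Y ⊕ b.Vert, inferInstance, _, _,
        (ctxCongr φ h1 SimpleGraph.Iso.refl (fun _ => Iff.rfl)).trans (ctxAssocRoot _ _ _ _ _ _),
        (ctxCongr ψ h2 SimpleGraph.Iso.refl (fun _ => Iff.rfl)).trans (ctxAssocRoot _ _ _ _ _ _),
        .inl ⟨?_, ?_⟩⟩
      · exact congrArg (fun z => Equiv.sumAssoc _ _ _ (Sum.inl z)) h1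
      · exact congrArg (fun z => Equiv.sumAssoc _ _ _ (Sum.inl z)) h2
    · refine ⟨p, hp, Y ⊕ b.Vert, inferInstance, _, _,
        (ctxCongr φ h1 SimpleGraph.Iso.refl (fun _ => Iff.rfl)).trans (ctxAssocRight _ _ _ _ _ _ _),
        (ctxCongr ψ h2 SimpleGraph.Iso.refl (fun _ => Iff.rfl)).trans (ctxAssocRight _ _ _ _ _ _ _),
        .inr ⟨.inl y, ?_, ?_⟩⟩
      · exact congrArg (fun z => Equiv.sumAssoc _ _ _ (Sum.inl z)) h1
      · exact congrArg (fun z => Equiv.sumAssoc _ _ _ (Sum.inl z)) h2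
  | @right b b' a _ ih =>
    -- Seen from the piece inside `b`, all of `a` is context. The root of the join is the root of
    -- `a`, so it ends up in the context.
    obtain ⟨p, hp, Y, _, L, N, φ, ψ, ⟨h1, h2⟩ | ⟨y, h1, h2⟩⟩ := ih
    · exact ⟨p, hp, Y ⊕ a.Vert, inferInstance, _, _,
        ((ctxComm _ _ _ _).trans (ctxCongr φ h1 SimpleGraph.Iso.refl
          (fun _ => Iff.rfl))).trans (ctxAssocRoot _ _ _ _ _ _),
        ((ctxComm _ _ _ _).trans (ctxCongr ψ h2 SimpleGraph.Iso.refl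
          (fun _ => Iff.rfl))).trans (ctxAssocRoot _ _ _ _ _ _),
        .inr ⟨.inr a.root, rfl, rfl⟩⟩
    · exact ⟨p, hp, Y ⊕ a.Vert, inferInstance, _, _,
        ((ctxComm _ _ _ _).trans (ctxCongr φ h1 SimpleGraph.Iso.refl
          (fun _ => Iff.rfl))).trans (ctxAssocRight _ _ _ _ _ _ _),
        ((ctxComm _ _ _ _).trans (ctxCongr ψ h2 SimpleGraph.Iso.refl
          (fun _ => Iff.rfl))).trans (ctxAssocRight _ _ _ _ _ _ _),
        .inr ⟨.inr a.root, rfl, rfl⟩⟩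
  | @iso a b c hab _ ih =>
    obtain ⟨χ, hχ⟩ := hab
    obtain ⟨p, hp, Y, _, L, N, φ, ψ, h⟩ := ih
    refine ⟨p, hp, Y, inferInstance, L, N, χ.trans φ, ψ, ?_⟩
    simpa [hχ] using h

end RTree

namespace RTree

/-! ### The rules and the trees that they do not reduce -/

/-- A new root above the root of `t`. -/
def stem (t : RTree) : RTree := ofList [t]

/-- The path with `n` edges, rooted at an end. -/
def path : ℕ → RTree
  | 0 => leaf
  | n + 1 => stem (path n)

/-- The path with two edges, rooted at its centre. -/
def cherry : RTree := ofList [leaf, leaf]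

/-- Two paths with two edges, attached to the root. -/
def twin : RTree := ofList [path 2, path 2]

/-- The path with two edges, extended by `n` new roots with a pendant leaf each. -/
def comb : ℕ → RTree
  | 0 => path 2
  | n + 1 => ofList [leaf, comb n]

/-- The rules, each with the tree after the operation first. -/
def rules : List (RTree × RTree) :=
  [(ofList [leaf, leaf, leaf], ofList [leaf, leaf]),
   (ofList [leaf, path 1], ofList [path 1]),
   (ofList [leaf, leaf, path 3], ofList [leaf, path 3]),
   (ofList [leaf, path 3], ofList [leaf, path 1]),
   (ofList [leaf, leaf, path 5], ofList [leaf, leaf, path 3]),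
   (ofList [leaf, twin], ofList [leaf, comb 1]),
   (ofList [path 2, comb 1], ofList [leaf, comb 1]),
   (ofList [leaf, leaf, comb 2], ofList [leaf, leaf, ofList [leaf, cherry]]),
   (ofList [cherry], leaf),
   (ofList [leaf, leaf, path 2], ofList [leaf, leaf]),
   (ofList [path 1, path 2], ofList [path 1]),
   (ofList [stem (comb 1)], ofList [path 2]),
   (ofList [leaf, path 2, path 2], ofList [leaf, path 2]),
   (ofList [path 2, path 3], ofList [path 3]),
   (ofList [stem twin], ofList [path 4]),
   (ofList [path 2, path 5], ofList [path 5]),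
   (ofList [path 2, path 2, path 2], ofList [path 2, path 2]),
   (ofList [path 2, comb 2], ofList [comb 2]),
   (ofList [leaf, path 5], ofList [path 3]),
   (ofList [stem (comb 3)], ofList [comb 2])]

/-- The rooted trees of excess `0` to which no rule applies. -/
def terminal : List RTree :=
  [leaf, path 1, cherry, path 2, path 3, comb 1, twin, path 4, stem (comb 1), comb 2, stem twin,
    path 5, stem (comb 2), comb 3, path 6, stem (comb 3)]

/-- The finite core of the converse: the list is closed under joins, except for joins with positive
excess or with a rule applicable at the root. -/
lemma terminal_join : ∀ a ∈ terminal, ∀ b ∈ terminal,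
    0 < (join a b).eval.excess ∨
    (∃ p ∈ rules, p.1.children.Subperm (join a b).children) ∨
    ∃ c ∈ terminal, (join a b).children.Perm c.children := by
  decide +kernel

/-- By superadditivity a positive excess of a branch passes to the join, and so does a reduction of
a branch. What remains are joins of two terminal trees. -/
lemma classification (t : RTree) :
    0 < t.eval.excess ∨ (∃ t', Step rules t t') ∨ ∃ c ∈ terminal, RIso t c := by
  induction t with
  | leaf => exact .inr (.inr ⟨leaf, by decide, RIso.refl _⟩)
  | join a b iha ihb =>
    have hj := excess_join a b
    have ha := excess_nonneg a
    have hb := excess_nonneg b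
    obtain h | ⟨t', h⟩ | ⟨c, hc, h⟩ := iha
    · left; omega
    · exact .inr (.inl ⟨_, h.left b⟩)
    obtain h' | ⟨t', h'⟩ | ⟨d, hd, h'⟩ := ihb
    · left; omega
    · exact .inr (.inl ⟨_, h'.right a⟩)
    have hcd := h.join h'
    obtain hx | ⟨p, hp, hs⟩ | ⟨e, he, hp⟩ := terminal_join c hc d hd
    · exact .inl (hcd.eval_eq ▸ hx)
    · obtain ⟨t', ht'⟩ := exists_step_of_subperm hp hs
      exact .inr (.inl ⟨t', .iso hcd ht'⟩)
    · have := RIso.of_perm hp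
      rw [ofList_children, ofList_children] at this
      exact .inr (.inr ⟨e, he, hcd.trans this⟩)

/-- Passing from `join a b` to `join b a` moves the root along the edge between the two roots; the
unrooted tree is the same, but a rule may now apply. -/
lemma terminal_small_or : ∀ t ∈ terminal, t.size ≤ 4 ∨ t.eval.i0 ≠ t.eval.d2 ∨
    ∃ a ∈ terminal, ∃ b ∈ terminal, t.children.Perm (join a b).children ∧
      ∃ p ∈ rules, p.1.children.Subperm (join b a).children := by
  decide +kernel

lemma rules_size : ∀ p ∈ rules, p.2.size < p.1.size := by decide +kernel

/-- The amount of the shift can be read off from any of the seven values; `d0` is used. -/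
lemma rules_eval : ∀ p ∈ rules, p.1.eval = p.2.eval.shift (p.1.eval.d0 - p.2.eval.d0) := by
  decide +kernel

/-- A tree of order at least `5` with equal numbers can be reduced, after a suitable choice of
the root. -/
lemma exists_step (t : RTree) (h : t.eval.i0 = t.eval.d2) (hs : 4 < t.size) :
    ∃ s t', Nonempty (t.graph ≃g s.graph) ∧ Step rules s t' := by
  have he : t.eval.excess ≤ t.eval.i0 - t.eval.d2 := min_le_left _ _
  obtain h0 | ⟨t', ht'⟩ | ⟨c, hc, htc⟩ := classification t
  · omega
  · exact ⟨t, t', ⟨SimpleGraph.Iso.refl⟩, ht'⟩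
  · have hev := htc.eval_eq
    obtain ⟨φ, -⟩ := htc
    have hcard : t.size = c.size := by
      rw [← card_vert, ← card_vert, Nat.card_congr φ.toEquiv]
    obtain h1 | h1 | ⟨a, -, b, -, hp, p, hpr, hsub⟩ := terminal_small_or c hc
    · omega
    · exact (h1 (hev ▸ h)).elim
    · obtain ⟨t', ht'⟩ := exists_step_of_subperm hpr hsub
      have := RIso.of_perm hp
      rw [ofList_children, ofList_children] at this
      obtain ⟨χ, -⟩ := this
      exact ⟨_, t', ⟨(φ.trans χ).trans (ctxComm _ _ _ _)⟩, ht'⟩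

end RTree

/-! ### Exchange of pieces whose values differ by a shift -/

section Transfer

variable {A A' Y : Type*} [Finite A] [Finite A'] [Finite Y] {a : SimpleGraph A}
  {a' : SimpleGraph A'} {r : A} {r' : A'}

/-- The exchange inequalities, used in both directions, show that each of the two numbers changes by
exactly `k`. -/
lemma ctx_equal_iff_of_shift {k : ℕ} (h : vals a r = (vals a' r').shift k) (L : SimpleGraph Y)
    (N : Set Y) :
    domVal (ctx a r L N) (.inl r) 2 = indVal (ctx a r L N) (.inl r) 0 ↔
      domVal (ctx a' r' L N) (.inl r') 2 = indVal (ctx a' r' L N) (.inl r') 0 := by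
  simp only [vals, Vals.shift, Vals.mk.injEq] at h
  obtain ⟨h0, h1, h2, h3, g0, g1, g2⟩ := h
  have d (l : ℕ) (hl : l ≤ 3) : domVal a r l = domVal a' r' l + k := by
    interval_cases l <;> assumption
  have i (l : ℕ) (hl : l ≤ 2) : indVal a r l = indVal a' r' l + k := by
    interval_cases l <;> assumption
  have e1 := domVal_ctx_le (a := a) (a' := a') (r := r) (r' := r') L N (m := k) (n := 0)
    fun l hl => by rw [d l hl]; omega
  have e2 := domVal_ctx_le (a := a') (a' := a) (r := r') (r' := r) L N (m := 0) (n := k)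
    fun l hl => by rw [d l hl]; omega
  have e3 := indVal_ctx_le (a := a) (a' := a') (r := r) (r' := r') L N (m := 0) (n := k)
    fun l hl => by rw [i l hl]; omega
  have e4 := indVal_ctx_le (a := a') (a' := a) (r := r') (r' := r) L N (m := k) (n := 0)
    fun l hl => by rw [i l hl]; omega
  omega

lemma equal_iff_of_iso {V : Type u} {W : Type*} [Finite V] {G : SimpleGraph V}
    {H : SimpleGraph W} (φ : G ≃g H) (w : W) :
    kDominationNumber G 2 = kIndependenceNumber G 2 ↔ domVal H w 2 = indVal H w 0 := by
  rw [kDominationNumber_eq_domVal G (φ.symm w), kIndependenceNumber_eq_indVal G (φ.symm w),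
    ← domVal_iso φ, ← indVal_iso φ, RelIso.apply_symm_apply]

end Transfer

/-! ### Concrete graphs as rooted trees -/

/-- The rooted graph `(G, w)` is isomorphic to the rooted tree `t`. -/
def Models {V : Type*} (G : SimpleGraph V) (w : V) (t : RTree) : Prop :=
  ∃ φ : t.graph ≃g G, φ t.root = w

lemma Models.vals_eq {V : Type*} {G : SimpleGraph V} {w : V} {t : RTree} :
    Models G w t → vals G w = t.eval := fun ⟨φ, h⟩ => by
  rw [← t.vals_eq_eval, ← h]
  simp only [vals, domVal_iso, indVal_iso]

namespace RTree

instance decidableEqVert : (t : RTree) → DecidableEq t.Vert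
  | leaf => inferInstanceAs (DecidableEq Unit)
  | join a b =>
    have := decidableEqVert a
    have := decidableEqVert b
    inferInstanceAs (DecidableEq (a.Vert ⊕ b.Vert))

instance fintypeVert : (t : RTree) → Fintype t.Vert
  | leaf => inferInstanceAs (Fintype Unit)
  | join a b =>
    have := fintypeVert a
    have := fintypeVert b
    inferInstanceAs (Fintype (a.Vert ⊕ b.Vert))

instance decidableAdj : (t : RTree) → DecidableRel t.graph.Adj
  | leaf => fun _ _ => .isFalse fun h => h
  | join a b =>
    fun
    | .inl x, .inl y => decidableAdj a x y
    | .inr x, .inr y => decidableAdj b x y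
    | .inl x, .inr y => inferInstanceAs (Decidable (x = a.root ∧ y = b.root))
    | .inr y, .inl x => inferInstanceAs (Decidable (x = a.root ∧ y = b.root))

/-- Label the vertices in preorder. -/
def label {X : Type*} : (t : RTree) → (ℕ → X) → t.Vert → X
  | leaf, f => fun _ => f 0
  | join a b, f => Sum.elim (a.label f) (b.label fun i => f (i + a.size))

end RTree

lemma models_of_label {V : Type*} [Finite V] {G : SimpleGraph V} {w : V} {t : RTree} (f : ℕ → V)
    (hc : Nat.card V = t.size) (hw : t.label f t.root = w)
    (hi : ∀ x y, t.label f x = t.label f y → x = y)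
    (ha : ∀ x y, G.Adj (t.label f x) (t.label f y) ↔ t.graph.Adj x y) : Models G w t := by
  have hb : Function.Bijective (t.label f) := by
    have := Fintype.ofFinite V
    rw [Fintype.bijective_iff_injective_and_card]
    refine ⟨fun x y => hi x y, ?_⟩
    rw [← Nat.card_eq_fintype_card, ← Nat.card_eq_fintype_card, t.card_vert, hc]
  exact ⟨⟨Equiv.ofBijective _ hb, ha _ _⟩, hw⟩

/-! ### A common form of the operations -/

/-- An operation on a PDI-subtree `S`: removal of the edges in `removed` and addition of `k`
vertices and the edges in `added`. -/
structure OpData where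
  S : SpecialTree
  k : ℕ
  removed : List (Sym2 (Fin S.order))
  added : List (Sym2 (Fin S.order ⊕ Fin k))

namespace OpData

/-- The result of applying the operation to the special tree itself. -/
def after (d : OpData) : SimpleGraph (Fin d.S.order ⊕ Fin d.k) :=
  (d.S.graph.deleteEdges {e | e ∈ d.removed} ⊕g ⊥) ⊔ SimpleGraph.fromEdgeSet {e | e ∈ d.added}

/-- The operation corresponds to a rule for rooted trees. -/
def IsRule (d : OpData) (p : RTree × RTree) : Prop :=
  Models d.S.graph d.S.white p.2 ∧ Models d.after (.inl d.S.white) p.1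

/-- Adding a vertex. -/
def addVertex (S : SpecialTree) : OpData := ⟨S, 1, [], [s(.inl S.v, .inr 0)]⟩

/-- Adding a path with one edge. -/
def addEdge (S : SpecialTree) : OpData :=
  ⟨S, 2, [], [s(.inr 0, .inr 1), s(.inl S.v, .inr 0)]⟩

/-- The one-vertex tree, which is a PDI-subtree at every vertex. -/
def point : SpecialTree := ⟨1, edgeGraph 1 [], 0, 0⟩

/-- Adding a path with two edges, attached by its centre. -/
def addCherry (S : SpecialTree) : OpData :=
  ⟨S, 3, [], [s(.inr 0, .inr 1), s(.inr 1, .inr 2), s(.inl S.v, .inr 1)]⟩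

/-- Adding a path with two edges, attached by an end. -/
def addPath (S : SpecialTree) : OpData :=
  ⟨S, 3, [], [s(.inr 0, .inr 1), s(.inr 1, .inr 2), s(.inl S.v, .inr 0)]⟩

/-- Adding an edge at one end of `T₆` and a vertex at the other end. -/
def addBoth : OpData :=
  ⟨T₆, 3, [], [s(.inr 0, .inr 2), s(.inl T₆v₁, .inr 0), s(.inl T₆v₂, .inr 1)]⟩

/-- Inserting a path into the edge `v₁v₂` of `T₁₄`. -/
def insertPath : OpData :=
  ⟨T₁₄, 3, [s(T₁₄v₁, T₁₄v₂)], [s(.inr 0, .inr 1), s(.inr 1, .inr 2), s(.inl T₁₄v₁, .inr 0),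
    s(.inl T₁₄v₂, .inr 1)]⟩

variable (d : OpData)

instance decidableAfter [DecidableRel d.S.graph.Adj] : DecidableRel d.after.Adj
  | .inl x, .inl y => decidable_of_iff ((d.S.graph.Adj x y ∧ s(x, y) ∉ d.removed) ∨
      (s(.inl x, .inl y) ∈ d.added ∧ x ≠ y)) (by simp [after])
  | .inl x, .inr y => decidable_of_iff (s(.inl x, .inr y) ∈ d.added) (by simp [after])
  | .inr x, .inl y => decidable_of_iff (s(.inr x, .inl y) ∈ d.added) (by simp [after])
  | .inr x, .inr y => decidable_of_iff (s(.inr x, .inr y) ∈ d.added ∧ x ≠ y) (by simp [after])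

/-- The vertex with number `l[i]` of the special tree. -/
def pick (l : List ℕ) (i : ℕ) : Fin d.S.order :=
  if h : l.getD i 0 < d.S.order then ⟨_, h⟩ else d.S.white

/-- The vertex with number `l[i]` after the operation, where the new vertices come last. -/
def pickAfter (l : List ℕ) (i : ℕ) : Fin d.S.order ⊕ Fin d.k :=
  if h : l.getD i 0 < d.S.order then .inl ⟨_, h⟩ else
  if h : l.getD i 0 - d.S.order < d.k then .inr ⟨_, h⟩ else .inl d.S.white

/-- Two explicit labellings reduce the claim to a decidable statement. The default values in `pick`
and `pickAfter` do no harm, because injectivity and adjacency are checked for the labellings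
themselves. -/
lemma isRule_of_labels [DecidableRel d.S.graph.Adj] {p : RTree × RTree} (l l' : List ℕ)
    (h : d.S.order = p.2.size ∧ d.S.order + d.k = p.1.size ∧
      p.2.label (d.pick l) p.2.root = d.S.white ∧
      p.1.label (d.pickAfter l') p.1.root = .inl d.S.white ∧
      (∀ x y, p.2.label (d.pick l) x = p.2.label (d.pick l) y → x = y) ∧
      (∀ x y, p.1.label (d.pickAfter l') x = p.1.label (d.pickAfter l') y → x = y) ∧
      (∀ x y, d.S.graph.Adj (p.2.label (d.pick l) x) (p.2.label (d.pick l) y) ↔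
        p.2.graph.Adj x y) ∧
      ∀ x y, d.after.Adj (p.1.label (d.pickAfter l') x) (p.1.label (d.pickAfter l') y) ↔
        p.1.graph.Adj x y) : d.IsRule p := by
  obtain ⟨h1, h2, h3, h4, h5, h6, h7, h8⟩ := h
  exact ⟨models_of_label (d.pick l) (by simpa using h1) h3 h5 h7,
    models_of_label (d.pickAfter l') (by simpa using h2) h4 h6 h8⟩

end OpData

/-! ### The operations are rules -/

instance decidableEdgeGraph (n : ℕ) (l : List (Fin n × Fin n)) :
    DecidableRel (edgeGraph n l).Adj :=
  fun a b => inferInstanceAs (Decidable (a ≠ b ∧ ((a, b) ∈ l ∨ (b, a) ∈ l)))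

instance : DecidableRel T₁.graph.Adj := inferInstanceAs (DecidableRel (edgeGraph 3 _).Adj)
instance : DecidableRel T₂.graph.Adj := inferInstanceAs (DecidableRel (edgeGraph 3 _).Adj)
instance : DecidableRel T₃.graph.Adj := inferInstanceAs (DecidableRel (edgeGraph 4 _).Adj)
instance : DecidableRel T₄.graph.Adj := inferInstanceAs (DecidableRel (edgeGraph 4 _).Adj)
instance : DecidableRel T₅.graph.Adj := inferInstanceAs (DecidableRel (edgeGraph 5 _).Adj)
instance : DecidableRel T₆.graph.Adj := inferInstanceAs (DecidableRel (edgeGraph 5 _).Adj)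
instance : DecidableRel T₇.graph.Adj := inferInstanceAs (DecidableRel (edgeGraph 6 _).Adj)
instance : DecidableRel T₈.graph.Adj := inferInstanceAs (DecidableRel (edgeGraph 6 _).Adj)
instance : DecidableRel T₉.graph.Adj := inferInstanceAs (DecidableRel (edgeGraph 7 _).Adj)
instance : DecidableRel T₁₀.graph.Adj := inferInstanceAs (DecidableRel (edgeGraph 7 _).Adj)
instance : DecidableRel T₁₁.graph.Adj := inferInstanceAs (DecidableRel (edgeGraph 7 _).Adj)
instance : DecidableRel T₁₂.graph.Adj := inferInstanceAs (DecidableRel (edgeGraph 7 _).Adj)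
instance : DecidableRel T₁₃.graph.Adj := inferInstanceAs (DecidableRel (edgeGraph 7 _).Adj)
instance : DecidableRel T₁₄.graph.Adj := inferInstanceAs (DecidableRel (edgeGraph 8 _).Adj)
instance : DecidableRel T₁₅.graph.Adj := inferInstanceAs (DecidableRel (edgeGraph 8 _).Adj)
instance : DecidableRel OpData.point.graph.Adj := inferInstanceAs (DecidableRel (edgeGraph 1 _).Adj)

namespace OpData
open RTree

instance (S : SpecialTree) [h : DecidableRel S.graph.Adj] :
    DecidableRel (addVertex S).S.graph.Adj := h
instance (S : SpecialTree) [h : DecidableRel S.graph.Adj] :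
    DecidableRel (addEdge S).S.graph.Adj := h
instance (S : SpecialTree) [h : DecidableRel S.graph.Adj] :
    DecidableRel (addCherry S).S.graph.Adj := h
instance (S : SpecialTree) [h : DecidableRel S.graph.Adj] :
    DecidableRel (addPath S).S.graph.Adj := h
instance : DecidableRel addBoth.S.graph.Adj := inferInstanceAs (DecidableRel T₆.graph.Adj)
instance : DecidableRel insertPath.S.graph.Adj := inferInstanceAs (DecidableRel T₁₄.graph.Adj)

/-- Here and below, the numbers list the root and then the branches from the last entry of `ofList`
to the first, since `ofList` joins its head last. New vertices are numbered from the order of the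
special tree on. -/
lemma isRule_addVertex_T₁ :
    (addVertex T₁).IsRule (ofList [leaf, leaf, leaf], ofList [leaf, leaf]) :=
  isRule_of_labels _ [1, 0, 2] [1, 0, 2, 3] (by decide +kernel)

lemma isRule_addVertex_T₂ :
    (addVertex T₂).IsRule (ofList [leaf, path 1], ofList [path 1]) :=
  isRule_of_labels _ [2, 1, 0] [2, 1, 0, 3] (by decide +kernel)

lemma isRule_addVertex_T₈ :
    (addVertex T₈).IsRule (ofList [leaf, leaf, path 3], ofList [leaf, path 3]) :=
  isRule_of_labels _ [1, 2, 3, 4, 5, 0] [1, 2, 3, 4, 5, 0, 6] (by decide +kernel)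

lemma isRule_addEdge_T₄ :
    (addEdge T₄).IsRule (ofList [leaf, path 3], ofList [leaf, path 1]) :=
  isRule_of_labels _ [1, 2, 3, 0] [1, 2, 3, 4, 5, 0] (by decide +kernel)

lemma isRule_addEdge_T₁₁ :
    (addEdge T₁₁).IsRule (ofList [leaf, leaf, path 5], ofList [leaf, leaf, path 3]) :=
  isRule_of_labels _ [0, 3, 4, 5, 6, 1, 2] [0, 3, 4, 5, 6, 7, 8, 1, 2] (by decide +kernel)

lemma isRule_addEdge_T₁₂ :
    (addEdge T₁₂).IsRule (ofList [leaf, twin], ofList [leaf, comb 1]) :=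
  isRule_of_labels _ [0, 1, 2, 3, 4, 5, 6] [0, 1, 2, 3, 4, 5, 7, 8, 6] (by decide +kernel)

lemma isRule_addEdge_T₁₃ :
    (addEdge T₁₃).IsRule (ofList [path 2, comb 1], ofList [leaf, comb 1]) :=
  isRule_of_labels _ [0, 1, 2, 3, 4, 5, 6] [0, 1, 2, 3, 4, 5, 6, 7, 8] (by decide +kernel)

lemma isRule_addEdge_T₁₅ :
    (addEdge T₁₅).IsRule (ofList [leaf, leaf, comb 2], ofList [leaf, leaf, ofList [leaf, cherry]]) :=
  isRule_of_labels _ [3, 2, 1, 0, 4, 5, 6, 7] [3, 2, 1, 0, 8, 9, 4, 5, 6, 7] (by decide +kernel)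

lemma isRule_addCherry :
    (addCherry point).IsRule (ofList [cherry], leaf) :=
  isRule_of_labels _ [0] [0, 2, 1, 3] (by decide +kernel)

lemma isRule_addPath_T₁ :
    (addPath T₁).IsRule (ofList [leaf, leaf, path 2], ofList [leaf, leaf]) :=
  isRule_of_labels _ [1, 0, 2] [1, 3, 4, 5, 0, 2] (by decide +kernel)

lemma isRule_addPath_T₂ :
    (addPath T₂).IsRule (ofList [path 1, path 2], ofList [path 1]) :=
  isRule_of_labels _ [2, 1, 0] [2, 3, 4, 5, 1, 0] (by decide +kernel)

lemma isRule_addPath_T₃ :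
    (addPath T₃).IsRule (ofList [stem (comb 1)], ofList [path 2]) :=
  isRule_of_labels _ [3, 2, 1, 0] [3, 2, 1, 4, 5, 6, 0] (by decide +kernel)

lemma isRule_addPath_T₅ :
    (addPath T₅).IsRule (ofList [leaf, path 2, path 2], ofList [leaf, path 2]) :=
  isRule_of_labels _ [1, 2, 3, 4, 0] [1, 2, 3, 4, 5, 6, 7, 0] (by decide +kernel)

lemma isRule_addPath_T₆ :
    (addPath T₆).IsRule (ofList [path 2, path 3], ofList [path 3]) :=
  isRule_of_labels _ [4, 3, 2, 1, 0] [4, 3, 2, 1, 0, 5, 6, 7] (by decide +kernel)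

lemma isRule_addPath_T₇ :
    (addPath T₇).IsRule (ofList [stem twin], ofList [path 4]) :=
  isRule_of_labels _ [5, 4, 3, 2, 1, 0] [5, 4, 3, 2, 1, 0, 6, 7, 8] (by decide +kernel)

lemma isRule_addPath_T₉ :
    (addPath T₉).IsRule (ofList [path 2, path 5], ofList [path 5]) :=
  isRule_of_labels _ [6, 5, 4, 3, 2, 1, 0] [6, 5, 4, 3, 2, 1, 0, 7, 8, 9] (by decide +kernel)

lemma isRule_addPath_T₁₀ :
    (addPath T₁₀).IsRule (ofList [path 2, path 2, path 2], ofList [path 2, path 2]) :=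
  isRule_of_labels _ [3, 2, 1, 0, 4, 5, 6] [3, 2, 1, 0, 4, 5, 6, 7, 8, 9] (by decide +kernel)

lemma isRule_addPath_T₁₄ :
    (addPath T₁₄).IsRule (ofList [path 2, comb 2], ofList [comb 2]) :=
  isRule_of_labels _ [0, 1, 2, 3, 4, 5, 6, 7] [0, 1, 2, 3, 4, 5, 6, 7, 8, 9, 10] (by decide +kernel)

lemma isRule_addBoth :
    addBoth.IsRule (ofList [leaf, path 5], ofList [path 3]) :=
  isRule_of_labels _ [4, 3, 2, 1, 0] [4, 3, 2, 1, 0, 5, 7, 6] (by decide +kernel)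

lemma isRule_insertPath :
    insertPath.IsRule (ofList [stem (comb 3)], ofList [comb 2]) :=
  isRule_of_labels _ [0, 1, 2, 3, 4, 5, 6, 7] [0, 8, 9, 1, 2, 3, 4, 5, 6, 7, 10] (by decide +kernel)

end OpData

/-! ### Operations on a graph split at the white vertex -/

lemma sym2_mk_mem_image_iff {A B : Type*} {g : A → B} (hg : Function.Injective g)
    {E : Set (Sym2 A)} {a b : A} : s(g a, g b) ∈ Sym2.map g '' E ↔ s(a, b) ∈ E := by
  rw [← Sym2.map_mk, (Sym2.map.injective hg).mem_set_image]

lemma sym2_mk_notMem_image {A B : Type*} {g : A → B} {E : Set (Sym2 A)} {x y : B}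
    (hy : y ∉ range g) : s(x, y) ∉ Sym2.map g '' E := by
  rintro ⟨e, -, he⟩
  have : y ∈ Sym2.map g e := he ▸ Sym2.mem_mk_right x y
  obtain ⟨a, -, rfl⟩ := Sym2.mem_map.1 this
  exact hy ⟨a, rfl⟩

lemma sym2_mk_notMem_image' {A B : Type*} {g : A → B} {E : Set (Sym2 A)} {x y : B}
    (hx : x ∉ range g) : s(x, y) ∉ Sym2.map g '' E :=
  Sym2.eq_swap (a := x) (b := y) ▸ sym2_mk_notMem_image hx

namespace OpData

variable (d : OpData)

/-- The graph that arises from `G'` by the operation, given the embedding `e` of the special tree,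
the embedding `f` of the old vertices and the new vertices `u`. -/
def apply {V W : Type*} (G' : SimpleGraph V) (e : Fin d.S.order → V) (f : V ↪ W)
    (u : Fin d.k → W) : SimpleGraph W :=
  (G'.deleteEdges (Sym2.map e '' {x | x ∈ d.removed})).map f ⊔
    SimpleGraph.fromEdgeSet (Sym2.map (Sum.elim (f ∘ e) u) '' {x | x ∈ d.added})

/-- `G` arises from `G'` by the operation. -/
def Rel {V W : Type*} (G' : SimpleGraph V) (G : SimpleGraph W) : Prop :=
  ∃ e : d.S.graph ↪g G', (∀ x, x ≠ d.S.white →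
      (G'.neighborSet (e x)).ncard = (d.S.graph.neighborSet x).ncard) ∧
    ∃ (f : V ↪ W) (u : Fin d.k → W), Function.Injective u ∧ (∀ w, w ∈ range u ↔ w ∉ range f) ∧
      G = d.apply G' e f u

variable {d} {V W Y : Type*} {G' : SimpleGraph V} {L : SimpleGraph Y} {N : Set Y}

/-- An operation acts inside the piece only: no removed or added edge has an end in the context, so
adjacencies involving context vertices survive, and inside the piece one sees `d.after`. -/
lemma apply_adj_iff (φ : ctx d.S.graph d.S.white L N ≃g G') (f : V ↪ W)
    (u : Fin d.k → W) (hu : Function.Injective u) (huf : ∀ i, u i ∉ range f)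
    (j : (Fin d.S.order ⊕ Fin d.k) ⊕ Y → W) (hj : Function.Injective j)
    (hj1 : ∀ x, j (.inl (.inl x)) = f (φ (.inl x))) (hj2 : ∀ i, j (.inl (.inr i)) = u i)
    (hj3 : ∀ y, j (.inr y) = f (φ (.inr y))) (a b) :
    (d.apply G' (φ ∘ Sum.inl) f u).Adj (j a) (j b) ↔
      (ctx d.after (.inl d.S.white) L N).Adj a b := by
  have he : Function.Injective (φ ∘ Sum.inl : Fin d.S.order → V) :=
    φ.injective.comp Sum.inl_injective
  have hel : Sum.elim (f ∘ φ ∘ Sum.inl) u = j ∘ Sum.inl := by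
    ext (x | x)
    · exact (hj1 x).symm
    · exact (hj2 x).symm
  have hinl : Function.Injective (j ∘ Sum.inl) := hj.comp Sum.inl_injective
  have hnr (y : Y) : j (.inr y) ∉ range (j ∘ Sum.inl) := by
    rintro ⟨x, hx⟩
    cases hj hx
  have hne (y : Y) : φ (.inr y) ∉ range (φ ∘ Sum.inl : Fin d.S.order → V) := by
    rintro ⟨x, hx⟩
    cases φ.injective hx
  have hmap1 (x : V) (i : Fin d.k) (H : SimpleGraph V) : ¬ (H.map f).Adj (f x) (u i) := by
    rintro ⟨-, a, b, -, -, hb⟩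
    exact huf i ⟨b, hb⟩
  have hmap2 (x : W) (i : Fin d.k) (H : SimpleGraph V) : ¬ (H.map f).Adj (u i) x := by
    rintro ⟨-, a, b, -, ha, -⟩
    exact huf i ⟨a, ha⟩
  have hmem (x y : Fin d.S.order ⊕ Fin d.k) (E : Set (Sym2 (Fin d.S.order ⊕ Fin d.k))) :
      s(j (.inl x), j (.inl y)) ∈ Sym2.map (j ∘ Sum.inl) '' E ↔ s(x, y) ∈ E :=
    sym2_mk_mem_image_iff hinl
  have hdel (x y : Fin d.S.order) (E : Set (Sym2 (Fin d.S.order))) :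
      s(φ (.inl x), φ (.inl y)) ∈ Sym2.map (φ ∘ Sum.inl) '' E ↔ s(x, y) ∈ E :=
    sym2_mk_mem_image_iff he
  rw [apply, hel, SimpleGraph.sup_adj, SimpleGraph.fromEdgeSet_adj]
  obtain (a | a) | a := a <;> obtain (b | b) | b := b
  · rw [hmem]
    simp only [hj1, SimpleGraph.map_adj_apply, SimpleGraph.deleteEdges_adj, hdel, φ.map_adj_iff]
    simp [after]
  · rw [hmem]
    simp only [hj1, hj2, hmap1]
    simp [after]
    rintro - h
    exact huf b ⟨_, h⟩
  · have := sym2_mk_notMem_image (E := {x | x ∈ d.added}) (x := j (.inl (.inl a))) (hnr b)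
    have h2 := sym2_mk_notMem_image (E := {x | x ∈ d.removed}) (x := φ (.inl a)) (hne b)
    simp only [this, false_and, or_false]
    simp only [hj1, hj3, SimpleGraph.map_adj_apply, SimpleGraph.deleteEdges_adj, h2,
      φ.map_adj_iff]
    simp
  · rw [hmem]
    simp only [hj1, hj2, hmap2]
    simp [after]
    rintro - h
    exact huf a ⟨_, h.symm⟩
  · rw [hmem]
    simp only [hj2, hmap2]
    simp [after, hu.eq_iff]
  · have := sym2_mk_notMem_image (E := {x | x ∈ d.added}) (x := j (.inl (.inr a))) (hnr b)
    simp only [this, false_and, or_false]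
    simp only [hj2, hj3, hmap2]
    simp
  · have := sym2_mk_notMem_image' (E := {x | x ∈ d.added}) (y := j (.inl (.inl b))) (hnr a)
    have h2 := sym2_mk_notMem_image' (E := {x | x ∈ d.removed}) (y := φ (.inl b)) (hne a)
    simp only [this, false_and, or_false]
    simp only [hj1, hj3, SimpleGraph.map_adj_apply, SimpleGraph.deleteEdges_adj, h2,
      φ.map_adj_iff]
    simp
  · have := sym2_mk_notMem_image' (E := {x | x ∈ d.added}) (y := j (.inl (.inr b))) (hnr a)
    simp only [this, false_and, or_false]
    simp only [hj2, hj3, hmap1]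
    simp
  · have := sym2_mk_notMem_image (E := {x | x ∈ d.added}) (x := j (.inr a)) (hnr b)
    have h2 := sym2_mk_notMem_image (E := {x | x ∈ d.removed}) (x := φ (.inr a)) (hne b)
    simp only [this, false_and, or_false]
    simp only [hj3, SimpleGraph.map_adj_apply, SimpleGraph.deleteEdges_adj, h2,
      φ.map_adj_iff]
    simp

/-- In such a context black vertices have no neighbours outside the piece, so their degrees are the
prescribed ones. -/
lemma rel_of_ctx {G : SimpleGraph W} (φ : G' ≃g ctx d.S.graph d.S.white L N)
    (ψ : G ≃g ctx d.after (.inl d.S.white) L N) : d.Rel G' G := by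
  let e : d.S.graph ↪g G' :=
    { toFun := φ.symm ∘ Sum.inl
      inj' := φ.symm.injective.comp Sum.inl_injective
      map_rel_iff' := by
        intro x y
        exact φ.symm.map_adj_iff }
  let f : V ↪ W :=
    { toFun := fun v => ψ.symm (Sum.map Sum.inl id (φ v))
      inj' := ψ.symm.injective.comp
        ((Sum.map_injective.2 ⟨Sum.inl_injective, Function.injective_id⟩).comp φ.injective) }
  let u : Fin d.k → W := fun i => ψ.symm (.inl (.inr i))
  have hf (v : V) : f v = ψ.symm (Sum.map Sum.inl id (φ v)) := rfl
  have huf (i : Fin d.k) : u i ∉ range f := by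
    rintro ⟨v, hv⟩
    have := ψ.symm.injective hv
    rcases h : φ v with x | x <;> simp [h] at this
  refine ⟨e, fun x hx => ?_, f, u, fun i i' h => ?_, fun w => ⟨?_, fun hw => ?_⟩, ?_⟩
  · rw [← ncard_image_of_injective (d.S.graph.neighborSet x) e.injective]
    congr 1
    ext v
    obtain ⟨y, rfl⟩ := φ.symm.surjective v
    change G'.Adj (φ.symm (.inl x)) _ ↔ ∃ z, d.S.graph.Adj x z ∧ φ.symm (.inl z) = φ.symm y
    rw [φ.symm.map_adj_iff]
    obtain y | y := y
    · simp
    · simp [hx]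
  · simpa using ψ.symm.injective h
  · rintro ⟨i, rfl⟩
    exact huf i
  · obtain ⟨(x | x) | x, rfl⟩ := ψ.symm.surjective w
    · exact (hw ⟨φ.symm (.inl x), by simp [hf]⟩).elim
    · exact ⟨x, rfl⟩
    · exact (hw ⟨φ.symm (.inr x), by simp [hf]⟩).elim
  · have key := apply_adj_iff φ.symm f u (fun i i' h => by simpa using ψ.symm.injective h) huf
      ψ.symm ψ.symm.injective (fun x => by simp [hf]) (fun _ => rfl) (fun y => by simp [hf])
    ext w w'
    obtain ⟨a, rfl⟩ := ψ.symm.surjective w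
    obtain ⟨b, rfl⟩ := ψ.symm.surjective w'
    rw [ψ.symm.map_adj_iff]
    exact (key a b).symm

/-- The context consists of the vertices outside the copy of the special tree; the degree condition
ensures that only the white vertex is adjacent to them. -/
lemma Rel.exists_ctx {V W : Type u} [Finite V] {G' : SimpleGraph V} {G : SimpleGraph W}
    (h : d.Rel G' G) :
    ∃ (Y : Type u) (_ : Finite Y) (L : SimpleGraph Y) (N : Set Y),
      Nonempty (G' ≃g ctx d.S.graph d.S.white L N) ∧
      Nonempty (G ≃g ctx d.after (.inl d.S.white) L N) := by
  obtain ⟨e, hPDI, f, u, hu, huf, rfl⟩ := h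
  let Y := {v // v ∉ range e}
  let L : SimpleGraph Y := G'.comap Subtype.val
  let N : Set Y := {y | G'.Adj (e d.S.white) y.1}
  have hadj (x : Fin d.S.order) (y : Y) : G'.Adj (e x) y.1 ↔ x = d.S.white ∧ y ∈ N := by
    refine ⟨fun hxy => ?_, fun ⟨h1, h2⟩ => h1 ▸ h2⟩
    by_cases hx : x = d.S.white
    · subst hx; exact ⟨rfl, hxy⟩
    -- The inclusion between finite sets of equal size is an equality, so a black vertex has all its
    -- neighbours in the copy.
    · have hs : e '' d.S.graph.neighborSet x ⊆ G'.neighborSet (e x) := by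
        rintro _ ⟨z, hz, rfl⟩
        exact e.map_adj_iff.2 hz
      have := eq_of_subset_of_ncard_le hs (by
        rw [ncard_image_of_injective _ e.injective, hPDI x hx])
      have hy : y.1 ∈ G'.neighborSet (e x) := hxy
      rw [← this] at hy
      obtain ⟨z, -, hz⟩ := hy
      exact (y.2 ⟨z, hz⟩).elim
  have hb : Function.Bijective (Sum.elim e Subtype.val : Fin d.S.order ⊕ Y → V) := by
    refine ⟨e.injective.sumElim Subtype.val_injective fun a b h => b.2 ⟨a, h⟩, fun v => ?_⟩
    by_cases hv : v ∈ range e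
    · obtain ⟨x, rfl⟩ := hv
      exact ⟨.inl x, rfl⟩
    · exact ⟨.inr ⟨v, hv⟩, rfl⟩
  let φ : ctx d.S.graph d.S.white L N ≃g G' :=
    { toEquiv := Equiv.ofBijective _ hb
      map_rel_iff' := by
        rintro (x | x) (y | y)
        · exact e.map_adj_iff
        · exact hadj x y
        · exact (G'.adj_comm _ _).trans (hadj y x)
        · exact Iff.rfl }
  let j : (Fin d.S.order ⊕ Fin d.k) ⊕ Y → W := Sum.elim (Sum.elim (f ∘ e) u) (f ∘ Subtype.val)
  have huf' (i : Fin d.k) : u i ∉ range f := (huf _).1 ⟨i, rfl⟩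
  have hj : Function.Bijective j := by
    refine ⟨((f.injective.comp e.injective).sumElim hu fun a b h => huf' b ⟨_, h⟩).sumElim
      (f.injective.comp Subtype.val_injective) ?_, fun w => ?_⟩
    · rintro (a | a) b h
      · exact b.2 ⟨a, f.injective h⟩
      · exact huf' a ⟨_, h.symm⟩
    · by_cases hw : w ∈ range u
      · obtain ⟨i, rfl⟩ := hw
        exact ⟨.inl (.inr i), rfl⟩
      · obtain ⟨v, rfl⟩ := not_not.1 (fun h => hw ((huf w).2 h))
        obtain ⟨x | y, rfl⟩ := hb.2 v
        · exact ⟨.inl (.inl x), rfl⟩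
        · exact ⟨.inr y, rfl⟩
  have key := apply_adj_iff φ f u hu huf' j hj.1 (fun _ => rfl) (fun _ => rfl) (fun _ => rfl)
  exact ⟨Y, inferInstance, L, N, ⟨φ.symm⟩,
    ⟨(⟨Equiv.ofBijective j hj, key _ _⟩ : ctx d.after (.inl d.S.white) L N ≃g _).symm⟩⟩

end OpData

/-! ### The six operations in the common form -/

lemma newVertices_ofFn_iff {V W : Type u} {f : V ↪ W} {n : ℕ} (u : Fin n → W) :
    NewVertices f (List.ofFn u) ↔
      Function.Injective u ∧ ∀ w, w ∈ range u ↔ w ∉ range f := by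
  simp only [NewVertices, List.nodup_ofFn, List.mem_ofFn']

namespace OpData

section Apply

variable {V W : Type*} (G' : SimpleGraph V) (f : V ↪ W) (S : SpecialTree)

lemma apply_mk {k : ℕ} (removed : List (Sym2 (Fin S.order)))
    (added : List (Sym2 (Fin S.order ⊕ Fin k))) (e : Fin S.order → V) (u : Fin k → W) :
    (⟨S, k, removed, added⟩ : OpData).apply G' e f u =
      (G'.deleteEdges {x | x ∈ removed.map (Sym2.map e)}).map f ⊔
        SimpleGraph.fromEdgeSet {x | x ∈ added.map (Sym2.map (Sum.elim (f ∘ e) u))} := by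
  rw [apply]
  congr 3 <;> ext <;> simp

lemma apply_addVertex (e : Fin S.order → V) (u : Fin 1 → W) :
    (addVertex S).apply G' e f u =
      G'.map f ⊔ SimpleGraph.fromEdgeSet {s(f (e S.v), u 0)} := by
  refine (apply_mk G' f _ _ _ e u).trans ?_
  simp only [List.map_nil, List.not_mem_nil, ofPred_false, SimpleGraph.deleteEdges_empty]
  congr 2
  ext
  simp

lemma apply_addEdge (e : Fin S.order → V) (u : Fin 2 → W) :
    (addEdge S).apply G' e f u =
      G'.map f ⊔ SimpleGraph.fromEdgeSet {s(u 0, u 1), s(f (e S.v), u 0)} := by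
  refine (apply_mk G' f _ _ _ e u).trans ?_
  simp only [List.map_nil, List.not_mem_nil, ofPred_false, SimpleGraph.deleteEdges_empty]
  congr 2
  ext
  simp

lemma apply_addCherry (e : Fin S.order → V) (u : Fin 3 → W) :
    (addCherry S).apply G' e f u = G'.map f ⊔
      SimpleGraph.fromEdgeSet {s(u 0, u 1), s(u 1, u 2), s(f (e S.v), u 1)} := by
  refine (apply_mk G' f _ _ _ e u).trans ?_
  simp only [List.map_nil, List.not_mem_nil, ofPred_false, SimpleGraph.deleteEdges_empty]
  congr 2
  ext
  simp

lemma apply_addPath (e : Fin S.order → V) (u : Fin 3 → W) :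
    (addPath S).apply G' e f u = G'.map f ⊔
      SimpleGraph.fromEdgeSet {s(u 0, u 1), s(u 1, u 2), s(f (e S.v), u 0)} := by
  refine (apply_mk G' f _ _ _ e u).trans ?_
  simp only [List.map_nil, List.not_mem_nil, ofPred_false, SimpleGraph.deleteEdges_empty]
  congr 2
  ext
  simp

lemma apply_addBoth (e : Fin T₆.order → V) (u : Fin 3 → W) :
    addBoth.apply G' e f u = G'.map f ⊔
      SimpleGraph.fromEdgeSet {s(u 0, u 2), s(f (e T₆v₁), u 0), s(f (e T₆v₂), u 1)} := by
  refine (apply_mk G' f _ _ _ e u).trans ?_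
  simp only [List.map_nil, List.not_mem_nil, ofPred_false, SimpleGraph.deleteEdges_empty]
  congr 2
  ext
  simp

lemma apply_insertPath (e : Fin T₁₄.order → V) (u : Fin 3 → W) :
    insertPath.apply G' e f u = (G'.deleteEdges {s(e T₁₄v₁, e T₁₄v₂)}).map f ⊔
      SimpleGraph.fromEdgeSet
        {s(u 0, u 1), s(u 1, u 2), s(f (e T₁₄v₁), u 0), s(f (e T₁₄v₂), u 1)} := by
  refine (apply_mk G' f _ _ _ e u).trans ?_
  refine congrArg₂ (· ⊔ ·) (congrArg (fun E => (G'.deleteEdges E).map f) ?_)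
    (congrArg SimpleGraph.fromEdgeSet ?_) <;> ext <;> simp

end Apply

variable {V W : Type u} {G' : SimpleGraph V} {G : SimpleGraph W}

lemma op₁_iff :
    Op₁ G' G ↔ ∃ S ∈ ({T₁, T₂, T₈} : Set SpecialTree), (addVertex S).Rel G' G := by
  refine exists_congr fun S => and_congr_right fun _ => ?_
  constructor
  · rintro ⟨_, ⟨e, he, rfl⟩, f, u, hu, rfl⟩
    obtain ⟨h1, h2⟩ := (newVertices_ofFn_iff ![u]).1 hu
    exact ⟨e, he, f, ![u], h1, h2, (apply_addVertex G' f S e ![u]).symm⟩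
  · rintro ⟨e, he, f, (u : Fin 1 → W), h1, h2, rfl⟩
    refine ⟨_, ⟨e, he, rfl⟩, f, u 0, ?_, apply_addVertex G' f S e u⟩
    simpa [List.ofFn_succ] using (newVertices_ofFn_iff u).2 ⟨h1, h2⟩

lemma op₂_iff :
    Op₂ G' G ↔ ∃ S ∈ ({T₄, T₁₁, T₁₂, T₁₃, T₁₅} : Set SpecialTree), (addEdge S).Rel G' G := by
  refine exists_congr fun S => and_congr_right fun _ => ?_
  constructor
  · rintro ⟨_, ⟨e, he, rfl⟩, f, u₁, u₂, hu, rfl⟩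
    obtain ⟨h1, h2⟩ := (newVertices_ofFn_iff ![u₁, u₂]).1 hu
    exact ⟨e, he, f, ![u₁, u₂], h1, h2, (apply_addEdge G' f S e ![u₁, u₂]).symm⟩
  · rintro ⟨e, he, f, (u : Fin 2 → W), h1, h2, rfl⟩
    refine ⟨_, ⟨e, he, rfl⟩, f, u 0, u 1, ?_, apply_addEdge G' f S e u⟩
    simpa [List.ofFn_succ] using (newVertices_ofFn_iff u).2 ⟨h1, h2⟩

lemma op₃_iff : Op₃ G' G ↔ (addCherry point).Rel G' G := by
  constructor
  · rintro ⟨v, f, u₁, u₂, u₃, hu, rfl⟩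
    obtain ⟨h1, h2⟩ := (newVertices_ofFn_iff ![u₁, u₂, u₃]).1 hu
    have hs : ∀ x y : Fin 1, x = y := Subsingleton.elim
    let e : point.graph ↪g G' :=
      { toFun := fun _ => v
        inj' := fun x y _ => hs x y
        map_rel_iff' := by
          intro x y
          rw [hs x y]
          simp }
    -- The only vertex of `point` is white, so there is no degree condition and any vertex `v` is
    -- admissible.
    exact ⟨e, fun x hx => (hx (hs _ _)).elim, f, ![u₁, u₂, u₃], h1, h2,
      (apply_addCherry G' f point e ![u₁, u₂, u₃]).symm⟩
  · rintro ⟨e, he, f, (u : Fin 3 → W), h1, h2, rfl⟩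
    refine ⟨e point.v, f, u 0, u 1, u 2, ?_, apply_addCherry G' f point e u⟩
    simpa [List.ofFn_succ] using (newVertices_ofFn_iff u).2 ⟨h1, h2⟩

lemma op₄_iff :
    Op₄ G' G ↔ ∃ S ∈ ({T₁, T₂, T₃, T₅, T₆, T₇, T₉, T₁₀, T₁₄} : Set SpecialTree),
      (addPath S).Rel G' G := by
  refine exists_congr fun S => and_congr_right fun _ => ?_
  constructor
  · rintro ⟨_, ⟨e, he, rfl⟩, f, u₁, u₂, u₃, hu, rfl⟩
    obtain ⟨h1, h2⟩ := (newVertices_ofFn_iff ![u₁, u₂, u₃]).1 hu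
    exact ⟨e, he, f, ![u₁, u₂, u₃], h1, h2, (apply_addPath G' f S e ![u₁, u₂, u₃]).symm⟩
  · rintro ⟨e, he, f, (u : Fin 3 → W), h1, h2, rfl⟩
    refine ⟨_, ⟨e, he, rfl⟩, f, u 0, u 1, u 2, ?_, apply_addPath G' f S e u⟩
    simpa [List.ofFn_succ] using (newVertices_ofFn_iff u).2 ⟨h1, h2⟩

lemma op₅_iff : Op₅ G' G ↔ addBoth.Rel G' G := by
  constructor
  · rintro ⟨e, he, f, u₁, u₂, u₃, hu, rfl⟩
    obtain ⟨h1, h2⟩ := (newVertices_ofFn_iff ![u₁, u₂, u₃]).1 hu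
    exact ⟨e, he, f, ![u₁, u₂, u₃], h1, h2, (apply_addBoth G' f e ![u₁, u₂, u₃]).symm⟩
  · rintro ⟨e, he, f, (u : Fin 3 → W), h1, h2, rfl⟩
    refine ⟨e, he, f, u 0, u 1, u 2, ?_, apply_addBoth G' f e u⟩
    simpa [List.ofFn_succ] using (newVertices_ofFn_iff u).2 ⟨h1, h2⟩

lemma op₆_iff : Op₆ G' G ↔ insertPath.Rel G' G := by
  constructor
  · rintro ⟨e, he, f, u₁, u₂, u₃, hu, rfl⟩
    obtain ⟨h1, h2⟩ := (newVertices_ofFn_iff ![u₁, u₂, u₃]).1 hu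
    exact ⟨e, he, f, ![u₁, u₂, u₃], h1, h2, (apply_insertPath G' f e ![u₁, u₂, u₃]).symm⟩
  · rintro ⟨e, he, f, (u : Fin 3 → W), h1, h2, rfl⟩
    refine ⟨e, he, f, u 0, u 1, u 2, ?_, apply_insertPath G' f e u⟩
    simpa [List.ofFn_succ] using (newVertices_ofFn_iff u).2 ⟨h1, h2⟩

open RTree

/-- Every operation corresponds to a rule. -/
lemma exists_rule (h : Op₁ G' G ∨ Op₂ G' G ∨ Op₃ G' G ∨ Op₄ G' G ∨ Op₅ G' G ∨ Op₆ G' G) :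
    ∃ d : OpData, d.Rel G' G ∧ ∃ p ∈ rules, d.IsRule p := by
  rw [op₁_iff, op₂_iff, op₃_iff, op₄_iff, op₅_iff, op₆_iff] at h
  obtain ⟨S, hS, h⟩ | ⟨S, hS, h⟩ | h | ⟨S, hS, h⟩ | h | h := h
  · refine ⟨_, h, ?_⟩
    obtain rfl | rfl | rfl := hS
    exacts [⟨_, by decide, isRule_addVertex_T₁⟩, ⟨_, by decide, isRule_addVertex_T₂⟩,
      ⟨_, by decide, isRule_addVertex_T₈⟩]
  · refine ⟨_, h, ?_⟩
    obtain rfl | rfl | rfl | rfl | rfl := hS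
    exacts [⟨_, by decide, isRule_addEdge_T₄⟩, ⟨_, by decide, isRule_addEdge_T₁₁⟩,
      ⟨_, by decide, isRule_addEdge_T₁₂⟩, ⟨_, by decide, isRule_addEdge_T₁₃⟩,
      ⟨_, by decide, isRule_addEdge_T₁₅⟩]
  · exact ⟨_, h, _, by decide, isRule_addCherry⟩
  · refine ⟨_, h, ?_⟩
    obtain rfl | rfl | rfl | rfl | rfl | rfl | rfl | rfl | rfl := hS
    exacts [⟨_, by decide, isRule_addPath_T₁⟩, ⟨_, by decide, isRule_addPath_T₂⟩,
      ⟨_, by decide, isRule_addPath_T₃⟩, ⟨_, by decide, isRule_addPath_T₅⟩,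
      ⟨_, by decide, isRule_addPath_T₆⟩, ⟨_, by decide, isRule_addPath_T₇⟩,
      ⟨_, by decide, isRule_addPath_T₉⟩, ⟨_, by decide, isRule_addPath_T₁₀⟩,
      ⟨_, by decide, isRule_addPath_T₁₄⟩]
  · exact ⟨_, h, _, by decide, isRule_addBoth⟩
  · exact ⟨_, h, _, by decide, isRule_insertPath⟩

/-- Every rule comes from an operation. -/
lemma exists_op {p : RTree × RTree} (hp : p ∈ rules) :
    ∃ d : OpData, d.IsRule p ∧ ∀ {V W : Type u} {G' : SimpleGraph V} {G : SimpleGraph W},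
      d.Rel G' G → TreeFamily G' → TreeFamily G := by
  have h1 {S : SpecialTree} {p} (hS : S ∈ ({T₁, T₂, T₈} : Set SpecialTree))
      (h : (addVertex S).IsRule p) : ∃ d : OpData, d.IsRule p ∧
        ∀ {V W : Type u} {G' : SimpleGraph V} {G : SimpleGraph W},
          d.Rel G' G → TreeFamily G' → TreeFamily G :=
    ⟨_, h, fun hr ht => .op₁ ht (op₁_iff.2 ⟨S, hS, hr⟩)⟩
  have h2 {S : SpecialTree} {p} (hS : S ∈ ({T₄, T₁₁, T₁₂, T₁₃, T₁₅} : Set SpecialTree))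
      (h : (addEdge S).IsRule p) : ∃ d : OpData, d.IsRule p ∧
        ∀ {V W : Type u} {G' : SimpleGraph V} {G : SimpleGraph W},
          d.Rel G' G → TreeFamily G' → TreeFamily G :=
    ⟨_, h, fun hr ht => .op₂ ht (op₂_iff.2 ⟨S, hS, hr⟩)⟩
  have h4 {S : SpecialTree} {p}
      (hS : S ∈ ({T₁, T₂, T₃, T₅, T₆, T₇, T₉, T₁₀, T₁₄} : Set SpecialTree))
      (h : (addPath S).IsRule p) : ∃ d : OpData, d.IsRule p ∧
        ∀ {V W : Type u} {G' : SimpleGraph V} {G : SimpleGraph W},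
          d.Rel G' G → TreeFamily G' → TreeFamily G :=
    ⟨_, h, fun hr ht => .op₄ ht (op₄_iff.2 ⟨S, hS, hr⟩)⟩
  simp only [rules, List.mem_cons, List.not_mem_nil, or_false] at hp
  obtain rfl | rfl | rfl | rfl | rfl | rfl | rfl | rfl | rfl | rfl | rfl | rfl | rfl | rfl | rfl |
    rfl | rfl | rfl | rfl | rfl := hp
  · exact h1 (by simp) isRule_addVertex_T₁
  · exact h1 (by simp) isRule_addVertex_T₂
  · exact h1 (by simp) isRule_addVertex_T₈
  · exact h2 (by simp) isRule_addEdge_T₄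
  · exact h2 (by simp) isRule_addEdge_T₁₁
  · exact h2 (by simp) isRule_addEdge_T₁₂
  · exact h2 (by simp) isRule_addEdge_T₁₃
  · exact h2 (by simp) isRule_addEdge_T₁₅
  · exact ⟨_, isRule_addCherry, fun hr ht => .op₃ ht (op₃_iff.2 hr)⟩
  · exact h4 (by simp) isRule_addPath_T₁
  · exact h4 (by simp) isRule_addPath_T₂
  · exact h4 (by simp) isRule_addPath_T₃
  · exact h4 (by simp) isRule_addPath_T₅
  · exact h4 (by simp) isRule_addPath_T₆
  · exact h4 (by simp) isRule_addPath_T₇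
  · exact h4 (by simp) isRule_addPath_T₉
  · exact h4 (by simp) isRule_addPath_T₁₀
  · exact h4 (by simp) isRule_addPath_T₁₄
  · exact ⟨_, isRule_addBoth, fun hr ht => .op₅ ht (op₅_iff.2 hr)⟩
  · exact ⟨_, isRule_insertPath, fun hr ht => .op₆ ht (op₆_iff.2 hr)⟩

end OpData

namespace RTree

/-! ### Finite trees and rooted trees -/

lemma isTree_graph : (t : RTree) → t.graph.IsTree
  | leaf => SimpleGraph.IsTree.of_subsingleton (V := Unit)
  | join a b => by
    have ha := SimpleGraph.isTree_iff_connected_and_card.1 a.isTree_graph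
    have hb := SimpleGraph.isTree_iff_connected_and_card.1 b.isTree_graph
    change (ctx a.graph a.root b.graph {b.root}).IsTree
    rw [ctx_singleton_eq, SimpleGraph.isTree_iff_connected_and_card]
    refine ⟨ha.1.sum_sup_edge hb.1, ?_⟩
    have h1 : ((a.graph ⊕g b.graph) ⊔ SimpleGraph.edge (.inl a.root) (.inr b.root)).edgeSet =
        insert s(.inl a.root, .inr b.root) (a.graph ⊕g b.graph).edgeSet := by
      have hne : (Sum.inl a.root : a.Vert ⊕ b.Vert) ≠ Sum.inr b.root := Sum.inl_ne_inr
      ext e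
      induction e with
      | h x y =>
        simp only [SimpleGraph.mem_edgeSet, SimpleGraph.sup_adj, SimpleGraph.edge_adj,
          mem_insert_iff, Sym2.eq_iff]
        constructor
        · rintro (h | ⟨h, -⟩)
          · exact .inr h
          · tauto
        · rintro ((⟨rfl, rfl⟩ | ⟨rfl, rfl⟩) | h)
          · exact .inr ⟨.inl ⟨rfl, rfl⟩, hne⟩
          · exact .inr ⟨.inr ⟨rfl, rfl⟩, hne.symm⟩
          · exact .inl h
    rw [Nat.card_coe_set_eq, h1, ncard_insert_of_notMem (by simp), ← Nat.card_coe_set_eq,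
      Nat.card_congr SimpleGraph.edgeSetSumEquiv, Nat.card_sum, Nat.card_sum, ← ha.2, ← hb.2]
    omega

/-- A leaf can be attached at any vertex of a rooted tree. -/
lemma exists_attach (t : RTree) (v : t.Vert) :
    ∃ t' : RTree, ∃ φ : ctx t.graph v (⊥ : SimpleGraph Unit) {()} ≃g t'.graph,
      φ (.inl t.root) = t'.root := by
  induction t with
  | leaf => exact ⟨join leaf leaf, SimpleGraph.Iso.refl, rfl⟩
  | join a b iha ihb =>
    obtain v | v := v
    · obtain ⟨a', φ, hφ⟩ := iha v
      exact ⟨join a' b, (ctxSwap a.graph a.root v b.graph {b.root} ⊥ {()}).trans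
        (ctxCongr φ hφ SimpleGraph.Iso.refl fun _ => Iff.rfl), congrArg Sum.inl hφ⟩
    · obtain ⟨b', φ, hφ⟩ := ihb v
      refine ⟨join a b', (ctxAssocRight a.graph a.root b.graph {b.root} v ⊥ {()}).trans
        (ctxCongr SimpleGraph.Iso.refl rfl φ fun y => ?_), rfl⟩
      rw [image_singleton, mem_singleton_iff, mem_singleton_iff, ← hφ, φ.injective.eq_iff]

/-- Every finite tree is the graph of a rooted tree. -/
lemma exists_iso_of_isTree {V : Type*} [Finite V] (G : SimpleGraph V) (hG : G.IsTree) :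
    ∃ t : RTree, Nonempty (G ≃g t.graph) := by
  induction hn : Nat.card V generalizing V with
  | zero =>
    have := hG.connected.nonempty
    exact (Nat.card_pos.ne' hn).elim
  | succ n ih =>
    have := hG.connected.nonempty
    obtain hs | hs := subsingleton_or_nontrivial V
    · have := uniqueOfSubsingleton (Classical.arbitrary V)
      exact ⟨leaf, ⟨⟨Equiv.ofUnique V Unit, by
        intro x y
        rw [Subsingleton.elim x y]
        exact iff_of_false (SimpleGraph.irrefl _) (SimpleGraph.irrefl _)⟩⟩⟩
    · classical
      have := Fintype.ofFinite V
      -- Remove a leaf, represent the smaller tree by induction, and attach the leaf again with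
      -- `exists_attach`.
      obtain ⟨x, hx⟩ := hG.exists_vert_degree_one_of_nontrivial
      have hc := hG.connected.induce_compl_singleton_of_degree_eq_one hx
      obtain ⟨y, hxy, hy⟩ := SimpleGraph.degree_eq_one_iff_existsUnique_adj.1 hx
      obtain ⟨t, ⟨φ⟩⟩ := ih (G.induce {x}ᶜ) ⟨hc, hG.isAcyclic.induce _⟩ (by
        have := ncard_add_ncard_compl ({x} : Set V)
        rw [ncard_singleton] at this
        rw [Nat.card_coe_set_eq]
        omega)
      let y' : ({x}ᶜ : Set V) := ⟨y, hxy.ne'⟩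
      have hadj (z : ({x}ᶜ : Set V)) : G.Adj z.1 x ↔ z = y' := by
        refine ⟨fun h => Subtype.ext (hy _ h.symm), ?_⟩
        rintro rfl
        exact hxy.symm
      have hb : Function.Bijective
          (Sum.elim Subtype.val fun _ => x : ({x}ᶜ : Set V) ⊕ Unit → V) := by
        refine ⟨Subtype.val_injective.sumElim (fun _ _ _ => rfl) fun a _ h => a.2 h, fun v => ?_⟩
        by_cases hv : v = x
        · exact ⟨.inr (), hv.symm⟩
        · exact ⟨.inl ⟨v, hv⟩, rfl⟩
      let ψ : ctx (G.induce {x}ᶜ) y' (⊥ : SimpleGraph Unit) {()} ≃g G :=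
        { toEquiv := Equiv.ofBijective _ hb
          map_rel_iff' := by
            rintro (z | z) (w | w)
            · exact Iff.rfl
            · exact (hadj z).trans (by simp)
            · exact (G.adj_comm _ _).trans ((hadj w).trans (by simp))
            · exact iff_of_false (SimpleGraph.irrefl _) (by simp) }
      obtain ⟨t', χ, -⟩ := t.exists_attach (φ y')
      exact ⟨t', ⟨(ψ.symm.trans (ctxCongr φ rfl SimpleGraph.Iso.refl fun _ => Iff.rfl)).trans χ⟩⟩

/-! ### Small trees -/

lemma size_pos : (t : RTree) → 0 < t.size
  | leaf => Nat.one_pos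
  | join a _ => Nat.add_pos_left a.size_pos _

lemma eq_of_size_le_one : {t : RTree} → t.size ≤ 1 → t = leaf
  | leaf, _ => rfl
  | join a b, h => by
    have := a.size_pos
    have := b.size_pos
    simp only [size] at h
    omega

lemma eq_of_size_eq_two {t : RTree} (h : t.size = 2) : t = join leaf leaf := by
  cases t with
  | leaf => cases h
  | join a b =>
    have := a.size_pos
    have := b.size_pos
    simp only [size] at h
    rw [eq_of_size_le_one (t := a) (by omega), eq_of_size_le_one (t := b) (by omega)]

lemma eq_of_size_eq_three {t : RTree} (h : t.size = 3) :
    t = join leaf (join leaf leaf) ∨ t = join (join leaf leaf) leaf := by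
  cases t with
  | leaf => cases h
  | join a b =>
    have := a.size_pos
    have := b.size_pos
    simp only [size] at h
    by_cases ha : a.size = 1
    · left
      rw [eq_of_size_le_one ha.le, eq_of_size_eq_two (t := b) (by omega)]
    · right
      rw [eq_of_size_le_one (t := b) (by omega), eq_of_size_eq_two (t := a) (by omega)]

lemma equal_of_size_le_four {t : RTree} (h : t.size ≤ 4) : t.eval.d2 = t.eval.i0 := by
  cases t with
  | leaf => rfl
  | join a b =>
    have := a.size_pos
    have := b.size_pos
    simp only [size] at h
    have h1 (s : RTree) (hs : 0 < s.size) (hs' : s.size ≤ 3) :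
        s = leaf ∨ s = join leaf leaf ∨ s = join leaf (join leaf leaf) ∨
          s = join (join leaf leaf) leaf := by
      obtain hs | hs | hs : s.size = 1 ∨ s.size = 2 ∨ s.size = 3 := by omega
      · exact .inl (eq_of_size_le_one hs.le)
      · exact .inr (.inl (eq_of_size_eq_two hs))
      · exact .inr (.inr (eq_of_size_eq_three hs))
    obtain rfl | rfl | rfl | rfl := h1 a a.size_pos (by omega) <;>
    obtain rfl | rfl | rfl | rfl := h1 b b.size_pos (by omega) <;>
    first | rfl | (simp only [size] at h; omega)

lemma equal_iff {V : Type u} [Finite V] {G : SimpleGraph V} {t : RTree} (φ : G ≃g t.graph) :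
    kDominationNumber G 2 = kIndependenceNumber G 2 ↔ t.eval.d2 = t.eval.i0 := by
  rw [equal_iff_of_iso φ t.root, ← vals_eq_eval]
  rfl

lemma vals_shift {p : RTree × RTree} (hp : p ∈ rules) {A B : Type*} {a : SimpleGraph A}
    {b : SimpleGraph B} {r : A} {s : B} (ha : Models a r p.1) (hb : Models b s p.2) :
    ∃ k, vals a r = (vals b s).shift k :=
  ⟨_, by rw [ha.vals_eq, hb.vals_eq]; exact rules_eval p hp⟩

/-! ### The characterization -/

/-- A reduction of a suitably re-rooted tree is an inverse operation: it gives a smaller tree, still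
with equality, from which the operation leads back. -/
lemma treeFamily_of_equal (t : RTree) (ht : t.eval.d2 = t.eval.i0) {V : Type u}
    (G : SimpleGraph V) (φ : G ≃g t.graph) : TreeFamily G := by
  induction hn : t.size using Nat.strong_induction_on generalizing t V with
  | _ n ih =>
  subst hn
  have := Finite.of_equiv _ φ.toEquiv.symm
  obtain hs | hs := le_or_gt t.size 4
  · exact .small G (φ.isTree_iff.2 t.isTree_graph)
      (by rwa [Nat.card_congr φ.toEquiv, t.card_vert])
  · obtain ⟨s, t', ⟨χ⟩, hstep⟩ := t.exists_step ht.symm hs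
    obtain ⟨p, hp, Y, _, L, N, α, β, -⟩ := hstep.exists_ctx
    obtain ⟨d, ⟨⟨δ, hδ⟩, ⟨ε, hε⟩⟩, hd⟩ := OpData.exists_op.{u} hp
    -- The vertices of rooted trees live in `Type`, while the family at hand lives in `Type u`.
    let G' : SimpleGraph (ULift.{u} t'.Vert) := t'.graph.comap ULift.down
    let ι : G' ≃g t'.graph := ⟨Equiv.ulift, Iff.rfl⟩
    have hG' := (ι.trans β).trans (ctxCongr δ hδ SimpleGraph.Iso.refl fun _ => Iff.rfl)
    have hts := (φ.trans χ).trans α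
    have hG := hts.trans (ctxCongr ε hε SimpleGraph.Iso.refl fun _ => Iff.rfl)
    refine hd (OpData.rel_of_ctx hG' hG) (ih t'.size ?_ t' ?_ G' ι rfl)
    -- Both trees share the context `Y`, so the orders compare as the two sides of the rule do.
    · have h1 := Nat.card_congr (χ.trans α).toEquiv
      have h2 := Nat.card_congr β.toEquiv
      have := rules_size p hp
      rw [Nat.card_sum, card_vert, card_vert] at h1 h2
      omega
    -- The shift carries equality from the larger tree down to `t'`.
    · obtain ⟨k, hk⟩ := vals_shift hp (r := p.1.root) (s := p.2.root)
        ⟨SimpleGraph.Iso.refl, rfl⟩ ⟨SimpleGraph.Iso.refl, rfl⟩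
      rw [← equal_iff SimpleGraph.Iso.refl, equal_iff_of_iso β (.inl p.2.root),
        ← ctx_equal_iff_of_shift hk L N, ← equal_iff_of_iso (χ.trans α),
        equal_iff SimpleGraph.Iso.refl]
      exact ht

end RTree

/-! ### Members of the family have equal numbers -/

lemma equal_of_op {V W : Type u} {G' : SimpleGraph V} {G : SimpleGraph W}
    (h' : Finite V ∧ kDominationNumber G' 2 = kIndependenceNumber G' 2)
    (h : Op₁ G' G ∨ Op₂ G' G ∨ Op₃ G' G ∨ Op₄ G' G ∨ Op₅ G' G ∨ Op₆ G' G) :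
    Finite W ∧ kDominationNumber G 2 = kIndependenceNumber G 2 := by
  obtain ⟨hV, h'⟩ := h'
  obtain ⟨d, hd, p, hp, h1, h2⟩ := OpData.exists_rule h
  obtain ⟨Y, _, L, N, ⟨φ⟩, ⟨ψ⟩⟩ := hd.exists_ctx
  obtain ⟨k, hk⟩ := RTree.vals_shift hp h2 h1
  have hW : Finite W := Finite.of_equiv _ ψ.toEquiv.symm
  refine ⟨hW, ?_⟩
  rwa [equal_iff_of_iso ψ (.inl (.inl d.S.white)), ctx_equal_iff_of_shift hk L N,
    ← equal_iff_of_iso φ]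

/-- Finiteness is carried through the induction, because only the small trees come with it while the
exchange argument needs it at every operation. -/
lemma TreeFamily.finite_and_equal {V : Type u} {G : SimpleGraph V} (h : TreeFamily G) :
    Finite V ∧ kDominationNumber G 2 = kIndependenceNumber G 2 := by
  induction h with
  | @small V hV G hG hc =>
    obtain ⟨t, ⟨φ⟩⟩ := RTree.exists_iso_of_isTree G hG
    rw [Nat.card_congr φ.toEquiv, t.card_vert] at hc
    exact ⟨hV, (RTree.equal_iff φ).2 (RTree.equal_of_size_le_four hc)⟩
  | op₁ _ h ih => exact equal_of_op ih (by tauto)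
  | op₂ _ h ih => exact equal_of_op ih (by tauto)
  | op₃ _ h ih => exact equal_of_op ih (by tauto)
  | op₄ _ h ih => exact equal_of_op ih (by tauto)
  | op₅ _ h ih => exact equal_of_op ih (by tauto)
  | op₆ _ h ih => exact equal_of_op ih (by tauto)

end TwoDom

theorem theorem1 {V : Type u} [Finite V] (T : SimpleGraph V) (hT : T.IsTree) :
    TwoDom.kDominationNumber T 2 = TwoDom.kIndependenceNumber T 2 ↔ TwoDom.TreeFamily T := by
  refine ⟨fun h => ?_, fun h => h.finite_and_equal.2⟩
  obtain ⟨t, ⟨φ⟩⟩ := TwoDom.RTree.exists_iso_of_isTree T hT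
  exact t.treeFamily_of_equal ((TwoDom.RTree.equal_iff φ).1 h) T φ
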